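/- **Conventions.** Let $G$ be a connected semisimple affine algebraic group over $\mathbb{C}$ with Lie algebra $\mathfrak{g}$ and Killing form $\langle\cdot,\cdot\rangle$, used to identify $\mathfrak{g}^*$ with $\mathfrak{g}$. A symplectic variety is a smooth affine variety over $\mathbb{C}$ with a closed, non-degenerate algebraic 2-form. Let $(X,\omega)$ be a symplectic variety with a Hamiltonian algebraic $G$-action and moment map $\mu:X\to\mathfrak{g}$: the action preserves $\omega$, $\mu$ is a $G$-equivariant morphism, and $d\langle\mu,z\rangle=\iota_{\tilde z}\omega$ for all $z\in\mathfrak{g}$, where $\tilde z_x=\frac{d}{dt}\big|_{t=0}\exp(tz)\cdot x$. Let $\tau=(\xi,h,\eta)$ be an $\mathfrak{sl}_2$-triple in $\mathfrak{g}$, i.e. $[\xi,\eta]=h$, $[h,\xi]=2\xi$, $[h,\eta]=-2\eta$ (the zero triple is allowed), and let $S_\tau=\xi+\ker(\mathrm{ad}_\eta)$ be its Slodowy slice. Equip $G\times S_\tau$ with the $G$-action $g\cdot(k,y)=(kg^{-1},y)$, the map $\mu_\tau(g,y)=-\mathrm{Ad}_{g^{-1}}(y)$, and the restriction $\Omega_\tau$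 of the symplectic form on $G\times\mathfrak{g}$ given at $(g,y)$ by $$\big((d_eR_g(y_1),z_1),(d_eR_g(y_2),z_2)\big)\mapsto\langle y_1,z_2\rangle-\langle y_2,z_1\rangle-\langle y,[y_1,y_2]\rangle ,$$ where $R_g$ is right multiplication by $g$. Let $G$ act diagonally on $X\times(G\times S_\tau)$, put $\tilde\mu(x,(g,y))=\mu(x)+\mu_\tau(g,y)$, and define $$(X\times(G\times S_\tau))/\!\!/G:=\operatorname{Spec}_{\max}\big(\mathbb{C}[\tilde\mu^{-1}(0)]^G\big),$$ with quotient map $\pi:\tilde\mu^{-1}(0)\to (X\times(G\times S_\tau))/\!\!/G$. Here closed subsets carry their reduced variety structure. **Proposition.** The map $\pi$ is surjective and its fibres are exactly the $G$-orbits in $\tilde\mu^{-1}(0)$. There is a unique 2-form $\overline\omega$ on $(X\times(G\times S_\tau))/\!\!/G$ such that $\pi^*\overline\omega$ is the restriction of $\omega\oplus\Omega_\tau$ to $\tilde\mu^{-1}(0)$, and it makes the quotient a symplectic variety. Moreover: (i) The map $$\overline\varphi:\mu^{-1}(S_\tau)\to(X\times(G\times S_\tau))/\!\!/G,\qquad x\mapsto\pi\big(x,(e,\mu(x))\big),$$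 is an isomorphism of affine varieties, with inverse induced by $(x,(g,y))\mapsto g\cdot x$. (ii) $\overline\varphi^*\overline\omega$ is the restriction of $\omega$ to $\mu^{-1}(S_\tau)$. (iii) $\mu^{-1}(S_\tau)$ is a symplectic subvariety of $X$: it is Zariski closed and smooth, and the restriction of $\omega$ to it is symplectic. -/

import Mathlib

open scoped TensorProduct

noncomputable section

namespace AffVar

universe u v w

/-! Classical affine varieties over `ℂ`: sets of points with an algebra of regular functions. -/

/-- A space with an algebra of (globally defined) regular functions with values in `ℂ`. -/
class HasRegularFunctions (X : Type u) where
  /-- The algebra of regular functions. -/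
  coordRing : Subalgebra ℂ (X → ℂ)

/-- The coordinate ring `ℂ[X]`. -/
abbrev CoordRing (X : Type u) [HasRegularFunctions X] : Type u :=
  (HasRegularFunctions.coordRing (X := X) : Subalgebra ℂ (X → ℂ))

/-- Evaluation of regular functions at a point. -/
def evalAt {X : Type u} [HasRegularFunctions X] (p : X) : CoordRing X →ₐ[ℂ] ℂ :=
  (Pi.evalAlgHom ℂ (fun _ : X => ℂ) p).comp (HasRegularFunctions.coordRing (X := X)).val

/-- An affine variety (not necessarily irreducible): the coordinate ring is a finitely generated
algebra, and the points are the `ℂ`-points (the maximal ideals) of the coordinate ring. -/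
class IsAffineVariety (X : Type u) [HasRegularFunctions X] : Prop where
  finiteType : Algebra.FiniteType ℂ (CoordRing X)
  evalAt_bijective : Function.Bijective (evalAt : X → (CoordRing X →ₐ[ℂ] ℂ))

/-- A morphism: a map that pulls regular functions back to regular functions. -/
structure Morphism (X : Type u) (Y : Type v) [HasRegularFunctions X] [HasRegularFunctions Y] where
  /-- The underlying map on points. -/
  toFun : X → Y
  regular : ∀ f : CoordRing Y, (fun x => f.1 (toFun x)) ∈ HasRegularFunctions.coordRing (X := X)

instance {X : Type u} {Y : Type v} [HasRegularFunctions X] [HasRegularFunctions Y] :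
    CoeFun (Morphism X Y) (fun _ => X → Y) := ⟨Morphism.toFun⟩

namespace Morphism

variable {X : Type u} {Y : Type v} {Z : Type w}
  [HasRegularFunctions X] [HasRegularFunctions Y] [HasRegularFunctions Z]

/-- The comorphism `φ^* : ℂ[Y] → ℂ[X]`. -/
def pullback (φ : Morphism X Y) : CoordRing Y →ₐ[ℂ] CoordRing X where
  toFun f := ⟨fun x => f.1 (φ x), φ.regular f⟩
  map_one' := rfl
  map_mul' _ _ := rfl
  map_zero' := rfl
  map_add' _ _ := rfl
  commutes' _ := rfl

/-- The identity morphism. -/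
def id (X : Type u) [HasRegularFunctions X] : Morphism X X := ⟨fun x => x, fun f => f.2⟩

/-- Composition of morphisms. -/
def comp (ψ : Morphism Y Z) (φ : Morphism X Y) : Morphism X Z :=
  ⟨fun x => ψ (φ x), fun f => φ.regular (ψ.pullback f)⟩

/-- A constant morphism. -/
def const (X : Type u) [HasRegularFunctions X] (y : Y) : Morphism X Y :=
  ⟨fun _ => y, fun f => (HasRegularFunctions.coordRing (X := X)).algebraMap_mem (f.1 y)⟩

/-- An isomorphism of varieties: a morphism with a two-sided inverse morphism. -/
def IsIso (φ : Morphism X Y) : Prop :=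
  ∃ ψ : Morphism Y X, (∀ x, ψ (φ x) = x) ∧ ∀ y, φ (ψ y) = y

end Morphism

/-! Closed subvarieties. -/

/-- The restriction of complex functions to a subset. -/
def restrictHom {X : Type u} (Z : Set X) : (X → ℂ) →ₐ[ℂ] (Z → ℂ) where
  toFun f := fun z => f z.1
  map_one' := rfl
  map_mul' _ _ := rfl
  map_zero' := rfl
  map_add' _ _ := rfl
  commutes' _ := rfl

/-- The regular functions on a (closed) subset are the restrictions of the ambient ones. -/
instance {X : Type u} [HasRegularFunctions X] (Z : Set X) : HasRegularFunctions Z :=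
  ⟨(HasRegularFunctions.coordRing (X := X)).map (restrictHom Z)⟩

/-- A Zariski closed subset: the zero locus of a set of regular functions. -/
def IsZariskiClosed {X : Type u} [HasRegularFunctions X] (Z : Set X) : Prop :=
  ∃ I : Set (CoordRing X), Z = {x | ∀ f ∈ I, f.1 x = 0}

/-- The inclusion of a subset. -/
def incl {X : Type u} [HasRegularFunctions X] (Z : Set X) : Morphism Z X :=
  ⟨fun z => z.1, fun f => ⟨f.1, f.2, rfl⟩⟩

/-- A morphism with values in a subset, viewed as a morphism to that subset. -/
def Morphism.codRestrict {X : Type u} {Y : Type v} [HasRegularFunctions X] [HasRegularFunctions Y]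
    (φ : Morphism X Y) (Z : Set Y) (h : ∀ x, φ x ∈ Z) : Morphism X Z where
  toFun x := ⟨φ x, h x⟩
  regular := by
    rintro ⟨_, f, hf, rfl⟩
    exact φ.regular ⟨f, hf⟩

/-! Products. -/

section Product

variable (X : Type u) (Y : Type v) [HasRegularFunctions X] [HasRegularFunctions Y]

/-- `f ↦ f ∘ pr₁`. -/
def fstHom : CoordRing X →ₐ[ℂ] (X × Y → ℂ) where
  toFun f := fun p => f.1 p.1
  map_one' := rfl
  map_mul' _ _ := rfl
  map_zero' := rfl
  map_add' _ _ := rfl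
  commutes' _ := rfl

/-- `f ↦ f ∘ pr₂`. -/
def sndHom : CoordRing Y →ₐ[ℂ] (X × Y → ℂ) where
  toFun f := fun p => f.1 p.2
  map_one' := rfl
  map_mul' _ _ := rfl
  map_zero' := rfl
  map_add' _ _ := rfl
  commutes' _ := rfl

/-- The regular functions on a product are the functions `∑ fᵢ(x) gᵢ(y)`, i.e. the image of
`ℂ[X] ⊗ ℂ[Y]`. -/
instance : HasRegularFunctions (X × Y) :=
  ⟨(Algebra.TensorProduct.productMap (fstHom X Y) (sndHom X Y)).range⟩

/-- The first projection. -/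
def fst : Morphism (X × Y) X :=
  ⟨Prod.fst, fun f => ⟨f ⊗ₜ 1, by
    rw [AlgHom.toRingHom_eq_coe, RingHom.coe_coe, Algebra.TensorProduct.productMap_apply_tmul,
      map_one, mul_one]; rfl⟩⟩

/-- The second projection. -/
def snd : Morphism (X × Y) Y :=
  ⟨Prod.snd, fun f => ⟨1 ⊗ₜ f, by
    rw [AlgHom.toRingHom_eq_coe, RingHom.coe_coe, Algebra.TensorProduct.productMap_apply_tmul,
      map_one, one_mul]; rfl⟩⟩

end Product

section ProductLemmas

variable {X : Type u} {Y : Type v} {Z : Type w}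
  [HasRegularFunctions X] [HasRegularFunctions Y] [HasRegularFunctions Z]

lemma mem_coordRing_prod_induction {P : (X × Y → ℂ) → Prop} (h0 : P 0)
    (hadd : ∀ F F', P F → P F' → P (F + F'))
    (hmul : ∀ (f : CoordRing X) (g : CoordRing Y), P (fun p => f.1 p.1 * g.1 p.2))
    {F : X × Y → ℂ} (hF : F ∈ HasRegularFunctions.coordRing (X := X × Y)) : P F := by
  obtain ⟨t, rfl⟩ := hF
  induction t with
  | zero => simpa using h0
  | tmul f g => exact hmul f g
  | add a b ha hb =>
    rw [map_add]
    exact hadd _ _ ha hb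

/-- The morphism into a product with given components. -/
def Morphism.prodMk (φ : Morphism Z X) (ψ : Morphism Z Y) : Morphism Z (X × Y) where
  toFun z := (φ z, ψ z)
  regular := by
    rintro ⟨F, hF⟩
    refine mem_coordRing_prod_induction
      (P := fun F => (fun z => F (φ z, ψ z)) ∈ HasRegularFunctions.coordRing (X := Z)) ?_ ?_ ?_ hF
    · exact zero_mem _
    · intro F F' h h'
      exact add_mem h h'
    · intro f g
      exact mul_mem (φ.regular f) (ψ.regular g)

/-- Applying a linear functional to a regular function on a product in the second variable gives a
regular function of the first variable. -/
lemma apply_slice_mem (φ : Morphism (X × Y) Z) (v : CoordRing Y →ₗ[ℂ] ℂ) (f : CoordRing Z) :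
    (fun x => v ((φ.comp ((Morphism.const Y x).prodMk (Morphism.id Y))).pullback f)) ∈
      HasRegularFunctions.coordRing (X := X) := by
  suffices H : ∀ F : X × Y → ℂ, F ∈ HasRegularFunctions.coordRing (X := X × Y) →
      ∃ h : ∀ x, (fun y => F (x, y)) ∈ HasRegularFunctions.coordRing (X := Y),
        (fun x => v ⟨fun y => F (x, y), h x⟩) ∈ HasRegularFunctions.coordRing (X := X) from
    (H _ (φ.regular f)).2
  intro F hF
  refine mem_coordRing_prod_induction (P := fun F =>
    ∃ h : ∀ x, (fun y => F (x, y)) ∈ HasRegularFunctions.coordRing (X := Y),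
        (fun x => v ⟨fun y => F (x, y), h x⟩) ∈ HasRegularFunctions.coordRing (X := X)) ?_ ?_ ?_ hF
  · refine ⟨fun _ => zero_mem _, ?_⟩
    have : (fun _ : X => v ⟨fun _ : Y => (0 : ℂ), zero_mem _⟩) = 0 := by
      funext x
      exact map_zero v
    exact this ▸ zero_mem _
  · rintro F F' ⟨h, k⟩ ⟨h', k'⟩
    refine ⟨fun x => add_mem (h x) (h' x), ?_⟩
    convert add_mem k k' using 1
    funext x
    exact map_add v ⟨_, h x⟩ ⟨_, h' x⟩
  · intro f g
    refine ⟨fun x => ((f.1 x) • g).2, ?_⟩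
    convert ((v g) • f).2 using 1
    funext x
    exact (map_smul v (f.1 x) g).trans (by simp [mul_comm])

end ProductLemmas

/-! Tangent spaces, differentials and differential 2-forms. -/

section Forms

variable {X : Type u} {Y : Type v} [HasRegularFunctions X] [HasRegularFunctions Y]

/-- The Zariski tangent space `T_p X`: point derivations of `ℂ[X]` at `p`. -/
def Tangent (p : X) : Submodule ℂ (CoordRing X →ₗ[ℂ] ℂ) where
  carrier := {v | ∀ f g : CoordRing X, v (f * g) = f.1 p * v g + g.1 p * v f}
  zero_mem' := by intro f g; simp
  add_mem' := by
    intro v w hv hw f g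
    simp only [LinearMap.add_apply, hv f g, hw f g]
    ring
  smul_mem' := by
    intro c v hv f g
    simp only [LinearMap.smul_apply, hv f g, smul_eq_mul]
    ring

/-- The differential `d_p φ : T_p X → T_{φ(p)} Y`. -/
def Morphism.differential (φ : Morphism X Y) (p : X) : Tangent p →ₗ[ℂ] Tangent (φ p) where
  toFun v := ⟨v.1.comp φ.pullback.toLinearMap, by
    intro f g
    simp only [LinearMap.comp_apply, AlgHom.toLinearMap_apply, map_mul]
    exact v.2 _ _⟩
  map_add' _ _ := rfl
  map_smul' _ _ := rfl

variable (X) in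
/-- A family of bilinear forms on the tangent spaces of `X`. -/
abbrev TwoForm : Type u := ∀ p : X, Tangent p →ₗ[ℂ] Tangent p →ₗ[ℂ] ℂ

/-- The pullback `φ^* ω`. -/
def TwoForm.pullback (φ : Morphism X Y) (ω : TwoForm Y) : TwoForm X :=
  fun p => (ω (φ p)).compl₁₂ (φ.differential p) (φ.differential p)

/-- The 2-form `∑ᵢ aᵢ dbᵢ ∧ dcᵢ`, evaluated at tangent vectors `v, w` at `p`. -/
def evalTwoForm {n : ℕ} (a b c : Fin n → CoordRing X) (p : X) (v w : Tangent p) : ℂ :=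
  ∑ i, (a i).1 p * (v.1 (b i) * w.1 (c i) - v.1 (c i) * w.1 (b i))

/-- The 3-form `d (∑ᵢ aᵢ dbᵢ ∧ dcᵢ) = ∑ᵢ daᵢ ∧ dbᵢ ∧ dcᵢ`, evaluated at tangent vectors
`v₁, v₂, v₃` at `p`. -/
def evalExteriorDerivative {n : ℕ} (a b c : Fin n → CoordRing X) (p : X)
    (v₁ v₂ v₃ : Tangent p) : ℂ :=
  ∑ i, Matrix.det !![v₁.1 (a i), v₁.1 (b i), v₁.1 (c i);
                     v₂.1 (a i), v₂.1 (b i), v₂.1 (c i);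
                     v₃.1 (a i), v₃.1 (b i), v₃.1 (c i)]

/-- An algebraic symplectic form: an algebraic 2-form `∑ᵢ aᵢ dbᵢ ∧ dcᵢ` that is closed and
non-degenerate on each tangent space. (On a smooth affine variety every algebraic 2-form has such an
expression, and its exterior derivative does not depend on the expression.) -/
structure IsSymplecticForm (ω : TwoForm X) : Prop where
  algebraic_closed : ∃ (n : ℕ) (a b c : Fin n → CoordRing X),
    (∀ p v w, ω p v w = evalTwoForm a b c p v w) ∧
    (∀ p v₁ v₂ v₃, evalExteriorDerivative a b c p v₁ v₂ v₃ = 0)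
  nondegenerate : ∀ p (v : Tangent p), (∀ w, ω p v w = 0) → v = 0

variable (X) in
/-- A symplectic variety: a smooth affine variety with an algebraic symplectic form. -/
structure IsSymplecticVariety (ω : TwoForm X) : Prop where
  affine : IsAffineVariety X
  smooth : Algebra.Smooth ℂ (CoordRing X)
  symplectic : IsSymplecticForm ω

/-- A symplectic subvariety: a closed subvariety to which the symplectic form restricts so as to
make it a symplectic variety. -/
structure IsSymplecticSubvariety (Z : Set X) (ω : TwoForm X) : Prop where
  closed : IsZariskiClosed Z
  symplectic : IsSymplecticVariety Z (TwoForm.pullback (incl Z) ω)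

end Forms

/-! Affine algebraic groups, their Lie algebras and actions. -/

/-- An affine algebraic group over `ℂ`. -/
class IsAlgebraicGroup (G : Type u) [Group G] [HasRegularFunctions G] : Prop
    extends IsAffineVariety G where
  mul_regular : ∀ f : CoordRing G,
    (fun p : G × G => f.1 (p.1 * p.2)) ∈ HasRegularFunctions.coordRing (X := G × G)
  inv_regular : ∀ f : CoordRing G,
    (fun g : G => f.1 g⁻¹) ∈ HasRegularFunctions.coordRing (X := G)

/-- An algebraic action: the action map `G × X → X` is a morphism. -/
class IsAlgebraicAction (G : Type u) (X : Type v) [Group G] [HasRegularFunctions G]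
    [HasRegularFunctions X] [MulAction G X] : Prop where
  smul_regular : ∀ f : CoordRing X,
    (fun p : G × X => f.1 (p.1 • p.2)) ∈ HasRegularFunctions.coordRing (X := G × X)

section Group

variable (G : Type u) [Group G] [HasRegularFunctions G] [IsAlgebraicGroup G]

/-- The multiplication morphism. -/
def mulMor : Morphism (G × G) G := ⟨fun p => p.1 * p.2, IsAlgebraicGroup.mul_regular⟩

variable {G}

/-- Left multiplication `L_g`. -/
def leftMul (g : G) : Morphism G G :=
  (mulMor G).comp ((Morphism.const G g).prodMk (Morphism.id G))

/-- Right multiplication `R_g`. -/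
def rightMul (g : G) : Morphism G G :=
  (mulMor G).comp ((Morphism.id G).prodMk (Morphism.const G g))

variable (G)

/-- The Lie algebra of left-invariant derivations of `ℂ[G]` (algebraic left-invariant vector
fields), with the commutator bracket. -/
def leftInvariantDerivations : LieSubalgebra ℂ (Derivation ℂ (CoordRing G) (CoordRing G)) where
  carrier := {D | ∀ (g : G) (f : CoordRing G),
    D ((leftMul g).pullback f) = (leftMul g).pullback (D f)}
  zero_mem' := by intro g f; simp
  add_mem' := by
    intro D E hD hE g f
    simp [hD g f, hE g f]
  smul_mem' := by
    intro c D hD g f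
    simp [hD g f]
  lie_mem' := by
    intro D E hD hE g f
    have hD' : ∀ g f, D ((leftMul g).pullback f) = (leftMul g).pullback (D f) := hD
    have hE' : ∀ g f, E ((leftMul g).pullback f) = (leftMul g).pullback (E f) := hE
    simp only [Derivation.commutator_apply, hD', hE', map_sub]

/-- The Lie algebra `𝔤` of `G`. -/
abbrev LieAlg : Type u := leftInvariantDerivations G

/-- The regular functions on the vector space `𝔤` are the polynomial functions. -/
instance : HasRegularFunctions (LieAlg G) :=
  ⟨Algebra.adjoin ℂ {f | ∃ l : Module.Dual ℂ (LieAlg G), f = fun z => l z}⟩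

variable {G}

/-- A linear functional as a regular function on `𝔤`. -/
def linearFun (l : Module.Dual ℂ (LieAlg G)) : CoordRing (LieAlg G) :=
  ⟨fun z => l z, Algebra.subset_adjoin ⟨l, rfl⟩⟩

/-- The regular function `⟨y, ·⟩` on `𝔤`, where `⟨·,·⟩` is the Killing form. -/
def killingFun (y : LieAlg G) : CoordRing (LieAlg G) := linearFun (killingForm ℂ (LieAlg G) y)

/-- The tangent vector at the identity of an element of `𝔤`. -/
def LieAlg.toTangent (z : LieAlg G) : Tangent (1 : G) :=
  ⟨(evalAt (1 : G)).toLinearMap.comp z.1.toLinearMap, by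
    intro f g
    change (z.1 (f * g)).1 1 = _
    rw [z.1.leibniz]
    rfl⟩

/-- The left-invariant vector field `D` with `d_e R_g (D_e) = v`, for a tangent vector `v` at `g`;
explicitly, `(D f)(h) = v(k ↦ f(h k g⁻¹))`. -/
def rightTrivFun (g : G) (v : Tangent g) : LieAlg G :=
  ⟨Derivation.mk'
    { toFun := fun f => ⟨fun h => v.1 ((leftMul h).pullback ((rightMul g⁻¹).pullback f)),
        apply_slice_mem (mulMor G) v.1 ((rightMul g⁻¹).pullback f)⟩
      map_add' := by
        intro f f'
        apply Subtype.ext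
        funext h
        simp
      map_smul' := by
        intro c f
        apply Subtype.ext
        funext h
        simp }
    (by
      intro f f'
      apply Subtype.ext
      funext h
      have key : ∀ F : CoordRing G,
          ((leftMul h).pullback ((rightMul g⁻¹).pullback F)).1 g = F.1 h := by
        intro F
        change F.1 (h * g * g⁻¹) = F.1 h
        rw [mul_inv_cancel_right]
      change v.1 ((leftMul h).pullback ((rightMul g⁻¹).pullback (f * f'))) = _
      rw [map_mul, map_mul, v.2, key, key]
      rfl), by
    intro k f
    apply Subtype.ext
    funext h
    change v.1 _ = v.1 _
    congr 1
    apply Subtype.ext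
    funext x
    change f.1 (k * (h * x * g⁻¹)) = f.1 (k * h * x * g⁻¹)
    simp only [mul_assoc]⟩

/-- The right trivialization `T_g G → 𝔤`, inverse to `d_e R_g`. -/
def rightTriv (g : G) : Tangent g →ₗ[ℂ] LieAlg G where
  toFun := rightTrivFun g
  map_add' _ _ := rfl
  map_smul' _ _ := rfl

/-- The adjoint action `Ad_g` on `𝔤`: conjugation of derivations by right translation, i.e.
`(Ad_g D)(f) = (D (f ∘ R_{g⁻¹})) ∘ R_g`. -/
def Ad (g : G) (D : LieAlg G) : LieAlg G :=
  ⟨Derivation.mk'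
    ((rightMul g).pullback.toLinearMap ∘ₗ D.1.toLinearMap ∘ₗ (rightMul g⁻¹).pullback.toLinearMap)
    (by
      have key : ∀ F : CoordRing G, (rightMul g).pullback ((rightMul g⁻¹).pullback F) = F := by
        intro F
        apply Subtype.ext
        funext h
        change F.1 (h * g * g⁻¹) = F.1 h
        rw [mul_inv_cancel_right]
      intro f f'
      simp [key]), by
    intro k f
    have comm : ∀ (x : G) (F : CoordRing G),
        (rightMul x).pullback ((leftMul k).pullback F) =
          (leftMul k).pullback ((rightMul x).pullback F) := by
      intro x F
      apply Subtype.ext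
      funext h
      change F.1 (k * (h * x)) = F.1 (k * h * x)
      rw [mul_assoc]
    change (rightMul g).pullback (D.1 ((rightMul g⁻¹).pullback ((leftMul k).pullback f))) =
      (leftMul k).pullback ((rightMul g).pullback (D.1 ((rightMul g⁻¹).pullback f)))
    rw [comm, D.2, comm]⟩

lemma Ad_one (D : LieAlg G) : Ad (1 : G) D = D := by
  have key : ∀ F : CoordRing G, (rightMul (1 : G)).pullback F = F := by
    intro F
    apply Subtype.ext
    funext h
    change F.1 (h * 1) = F.1 h
    rw [mul_one]
  apply Subtype.ext
  ext1 f
  change (rightMul (1 : G)).pullback (D.1 ((rightMul (1 : G)⁻¹).pullback f)) = D.1 f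
  rw [inv_one, key, key]

end Group

section Action

variable (G : Type u) [Group G] [HasRegularFunctions G]
  {X : Type v} [HasRegularFunctions X] [MulAction G X] [IsAlgebraicAction G X]

/-- The action morphism `G × X → X`. -/
def actMor (G : Type u) [Group G] [HasRegularFunctions G]
    (X : Type v) [HasRegularFunctions X] [MulAction G X] [IsAlgebraicAction G X] :
    Morphism (G × X) X :=
  ⟨fun p => p.1 • p.2, IsAlgebraicAction.smul_regular⟩

variable {G}

/-- The morphism `x ↦ g • x`. -/
def actBy (g : G) : Morphism X X :=
  (actMor G X).comp ((Morphism.const X g).prodMk (Morphism.id X))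

variable (G)

/-- The orbit morphism `g ↦ g • x`. -/
def orbitMor (x : X) : Morphism G X :=
  (actMor G X).comp ((Morphism.id G).prodMk (Morphism.const G x))

variable {G} [IsAlgebraicGroup G]

/-- The fundamental vector field `z̃` of `z ∈ 𝔤` at `x`, i.e. `d/dt exp(tz) • x` at `t = 0`,
described as a point derivation. -/
def fundamental (z : LieAlg G) (x : X) : CoordRing X →ₗ[ℂ] ℂ :=
  z.toTangent.1.comp (orbitMor G x).pullback.toLinearMap

lemma fundamental_mem (z : LieAlg G) (x : X) : fundamental z x ∈ Tangent x := by
  have e : (orbitMor G x) (1 : G) = x := one_smul G x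
  intro f f'
  refine (((orbitMor G x).differential 1 z.toTangent).2 f f').trans ?_
  change f.1 ((orbitMor G x) (1 : G)) * fundamental z x f' +
    f'.1 ((orbitMor G x) (1 : G)) * fundamental z x f = _
  rw [e]

/-- A Hamiltonian action with a moment map `μ : X → 𝔤`, where `𝔤` is identified with its dual by
the Killing form: the action preserves `ω`, `μ` is `G`-equivariant, and `d(μ^z) = ι_{z̃} ω` for all
`z ∈ 𝔤`, where `μ^z(x) = ⟨z, μ(x)⟩`. -/
structure IsHamiltonian (ω : TwoForm X) (μ : Morphism X (LieAlg G)) : Prop where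
  invariant : ∀ g : G, TwoForm.pullback (actBy g) ω = ω
  equivariant : ∀ (g : G) (x : X), μ (g • x) = Ad g (μ x)
  moment : ∀ (z : LieAlg G) (x : X) (v : Tangent x),
    v.1 (μ.pullback (killingFun z)) = ω x ⟨fundamental z x, fundamental_mem z x⟩ v

end Action

/-! Symplectic quotients. -/

section Quotient

variable (G : Type u) [Group G] {M : Type v} [HasRegularFunctions M] [MulAction G M]
  {V : Type w} [Zero V]

/-- The zero fibre `μ⁻¹(0)` of a moment map. -/
def zeroFiber (μ : M → V) : Set M := {p | μ p = 0}

/-- The algebra `ℂ[μ⁻¹(0)]^G` of regular functions that are constant on the `G`-orbits. -/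
def invariants (μ : M → V) : Subalgebra ℂ (CoordRing (zeroFiber μ)) where
  carrier := {f | ∀ (g : G) (p q : zeroFiber μ), q.1 = g • p.1 → f.1 q = f.1 p}
  mul_mem' := by
    intro f f' hf hf' g p q h
    simp [hf g p q h, hf' g p q h]
  add_mem' := by
    intro f f' hf hf' g p q h
    simp [hf g p q h, hf' g p q h]
  algebraMap_mem' := by intro r g p q _; rfl

/-- The quotient `μ⁻¹(0)/G := Spec_max(ℂ[μ⁻¹(0)]^G)`; its points are the `ℂ`-points of the algebra
of invariants. -/
@[ext]
structure SymplecticQuotient (μ : M → V) : Type v where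
  /-- The algebra homomorphism corresponding to a point. -/
  toHom : invariants G μ →ₐ[ℂ] ℂ

/-- Elements of `ℂ[μ⁻¹(0)]^G` as functions on `Spec_max(ℂ[μ⁻¹(0)]^G)`. -/
def quotientEval (μ : M → V) : invariants G μ →ₐ[ℂ] (SymplecticQuotient G μ → ℂ) where
  toFun f := fun χ => χ.toHom f
  map_one' := by funext χ; exact map_one χ.toHom
  map_mul' f f' := by funext χ; exact map_mul χ.toHom f f'
  map_zero' := by funext χ; exact map_zero χ.toHom
  map_add' f f' := by funext χ; exact map_add χ.toHom f f'
  commutes' r := by funext χ; exact χ.toHom.commutes r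

instance (μ : M → V) : HasRegularFunctions (SymplecticQuotient G μ) :=
  ⟨(quotientEval G μ).range⟩

/-- The quotient map `π : μ⁻¹(0) → μ⁻¹(0)/G`. -/
def quotientMap (μ : M → V) : Morphism (zeroFiber μ) (SymplecticQuotient G μ) where
  toFun p := ⟨(evalAt p).comp (invariants G μ).val⟩
  regular := by
    rintro ⟨_, f, rfl⟩
    exact f.1.2

/-- `ω̄` is a reduced form of `ω` if `π^* ω̄ = j^* ω`, with `j : μ⁻¹(0) → M` the inclusion. -/
def IsReducedForm (μ : M → V) (ω : TwoForm M) (ω' : TwoForm (SymplecticQuotient G μ)) : Prop :=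
  TwoForm.pullback (quotientMap G μ) ω' = TwoForm.pullback (incl (zeroFiber μ)) ω

end Quotient

/-! Slodowy slices. -/

section Slodowy

/-- An `𝔰𝔩₂`-triple `(ξ, h, η)`; the zero triple is allowed. -/
structure IsTriple {L : Type u} [LieRing L] (ξ h η : L) : Prop where
  lie_e_f : ⁅ξ, η⁆ = h
  lie_h_e : ⁅h, ξ⁆ = 2 • ξ
  lie_h_f : ⁅h, η⁆ = -(2 • η)

/-- The Slodowy slice `ξ + ker(ad_η)`. -/
def slodowySlice {L : Type u} [LieRing L] (ξ η : L) : Set L := {x | ∃ k, ⁅η, k⁆ = 0 ∧ x = ξ + k}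

variable {G : Type u} [Group G] [HasRegularFunctions G] [IsAlgebraicGroup G]

variable (G) in
/-- The symplectic form on `G × 𝔤 ≅ T^*G` (right trivialization, Killing form):
`Ω((y₁ g, z₁), (y₂ g, z₂)) = ⟨y₁, z₂⟩ - ⟨y₂, z₁⟩ - ⟨x, [y₁, y₂]⟩` at `(g, x)`. Here `⟨y, z⟩` for a
tangent vector `z` of `𝔤` is the derivative of the linear function `⟨y, ·⟩` along `z`. -/
def omegaR : TwoForm (G × LieAlg G) := fun p =>
  let y : Tangent p →ₗ[ℂ] LieAlg G := rightTriv p.1 ∘ₗ (fst G (LieAlg G)).differential p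
  let z : Tangent p →ₗ[ℂ] Tangent p.2 := (snd G (LieAlg G)).differential p
  LinearMap.mk₂ ℂ
    (fun u₁ u₂ => (z u₂).1 (killingFun (y u₁)) - (z u₁).1 (killingFun (y u₂))
      - killingForm ℂ (LieAlg G) p.2 ⁅y u₁, y u₂⁆)
    (by
      intro u u' w
      have h : killingFun (y u + y u') = killingFun (y u) + killingFun (y u') := by
        apply Subtype.ext; funext x; simp [killingFun, linearFun]
      simp only [map_add, h, Submodule.coe_add, LinearMap.add_apply, add_lie]
      ring)
    (by
      intro c u w
      have h : killingFun (c • y u) = c • killingFun (y u) := by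
        apply Subtype.ext; funext x; simp [killingFun, linearFun]
      simp only [map_smul, h, Submodule.coe_smul, LinearMap.smul_apply, smul_lie, smul_eq_mul]
      ring)
    (by
      intro w u u'
      have h : killingFun (y u + y u') = killingFun (y u) + killingFun (y u') := by
        apply Subtype.ext; funext x; simp [killingFun, linearFun]
      simp only [map_add, h, Submodule.coe_add, LinearMap.add_apply, lie_add]
      ring)
    (by
      intro c w u
      have h : killingFun (c • y u) = c • killingFun (y u) := by
        apply Subtype.ext; funext x; simp [killingFun, linearFun]
      simp only [map_smul, h, Submodule.coe_smul, LinearMap.smul_apply, lie_smul, smul_eq_mul]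
      ring)

/-- The variety `G × S`, for a subset `S` of `𝔤`. -/
def GroupProd (S : Set (LieAlg G)) : Type u := G × S

instance (S : Set (LieAlg G)) : HasRegularFunctions (GroupProd S) :=
  inferInstanceAs (HasRegularFunctions (G × S))

/-- The action `g • (h, x) = (h g⁻¹, x)` on `G × S`. -/
instance (S : Set (LieAlg G)) : MulAction G (GroupProd S) where
  smul g p := (p.1 * g⁻¹, p.2)
  one_smul p := by
    change (p.1 * (1 : G)⁻¹, p.2) = p
    simp only [inv_one, mul_one]
    rfl
  mul_smul g h p := by
    change (p.1 * (g * h)⁻¹, p.2) = (p.1 * h⁻¹ * g⁻¹, p.2)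
    rw [mul_inv_rev, mul_assoc]

/-- The inclusion `G × S → G × 𝔤`. -/
def groupProdIncl (S : Set (LieAlg G)) : Morphism (GroupProd S) (G × LieAlg G) :=
  (fst G S).prodMk ((incl S).comp (snd G S))

/-- The moment map `(g, x) ↦ -Ad_{g⁻¹}(x)` of `G × S`. -/
def groupProdMoment (S : Set (LieAlg G)) (p : GroupProd S) : LieAlg G := -Ad p.1⁻¹ p.2.1

variable {X : Type v} [HasRegularFunctions X]

/-- The moment map `(x, (g, y)) ↦ μ(x) - Ad_{g⁻¹}(y)` of `X × (G × S)`, which carries the diagonal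
`G`-action. -/
def totalMoment (μ : Morphism X (LieAlg G)) (S : Set (LieAlg G)) (p : X × GroupProd S) : LieAlg G :=
  μ p.1 + groupProdMoment S p.2

/-- The symplectic form `ω ⊕ Ω|_{G × S}` on `X × (G × S)`. -/
def totalForm (ω : TwoForm X) (S : Set (LieAlg G)) : TwoForm (X × GroupProd S) :=
  TwoForm.pullback (fst X (GroupProd S)) ω +
    TwoForm.pullback ((groupProdIncl S).comp (snd X (GroupProd S))) (omegaR G)

/-- The closed subvariety `μ⁻¹(S)` of `X`. -/
def slicePreimage (μ : Morphism X (LieAlg G)) (S : Set (LieAlg G)) : Set X := {x | μ x ∈ S}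

/-- The morphism `x ↦ (x, (e, μ(x)))` from `μ⁻¹(S)` to the zero fibre in `X × (G × S)`. -/
def sliceLift (μ : Morphism X (LieAlg G)) (S : Set (LieAlg G)) :
    Morphism (slicePreimage μ S) (zeroFiber (totalMoment μ S)) :=
  let φ : Morphism (slicePreimage μ S) (X × GroupProd S) :=
    (incl (slicePreimage μ S)).prodMk
      ((Morphism.const (slicePreimage μ S) (1 : G)).prodMk
        ((μ.comp (incl (slicePreimage μ S))).codRestrict S fun x => x.2))
  φ.codRestrict (zeroFiber (totalMoment μ S)) (by
    intro x
    change μ x.1 + -Ad (1 : G)⁻¹ (μ x.1) = 0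
    rw [inv_one, Ad_one, add_neg_cancel])

variable [MulAction G X]

/-- The canonical morphism `x ↦ [(x, (e, μ(x)))]` from `μ⁻¹(S)` to the symplectic quotient of
`X × (G × S)` by `G`. -/
def canonicalMap (μ : Morphism X (LieAlg G)) (S : Set (LieAlg G)) :
    Morphism (slicePreimage μ S) (SymplecticQuotient G (totalMoment μ S)) :=
  (quotientMap G (totalMoment μ S)).comp (sliceLift μ S)

end Slodowy

end AffVar

end

open scoped TensorProduct

noncomputable section

namespace AffVar

universe u v w

/-! ### Linear algebra of weight decompositions. -/

section Sl2

/-! On the zero fibre the condition $\tilde\mu = 0$ together with equivariance says $\mu(g\cdot x) =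
y$. Hence acting by the group coordinate $g$ moves a point $(x,(g,y))$ to $(g\cdot x,(e,\mu(g\cdot
x)))$: every orbit meets the section $x \mapsto (x,(e,\mu(x)))$ of $\mu^{-1}(S)$ exactly once, and
$(x,(g,y)) \mapsto g\cdot x$ is an invariant retraction onto it (`sliceLift_sliceProj`). Pulling
back along the two maps identifies $\mathbb{C}[\tilde\mu^{-1}(0)]^G$ with $\mathbb{C}[\mu^{-1}(S)]$,
so the quotient is $\mu^{-1}(S)$, its points are the orbits, and no general theory of quotients is
needed.

The forms match because the pullback of $\omega$ along $(x,(g,y)) \mapsto g\cdot x$ is the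
restriction of $\omega\oplus\Omega_\tau$ (`totalForm_zeroFiber`): split the derivative of $g\cdot x$
into a fundamental vector and a translated vector, then use the moment map identity and the
invariance of $\omega$.

What remains is that $\mu^{-1}(S_\tau)$ is smooth and symplectic. With $z_i$ a basis of
$\operatorname{im}(\mathrm{ad}_\eta)$, it is cut out by $f_i = \langle z_i,\mu - \xi\rangle$, and
the fundamental fields satisfy $\tilde z_j(f_i) = \langle z_i,[z_j,\mu]\rangle$. This matrix is
invertible on the slice, which amounts to $\operatorname{im}(\mathrm{ad}_\eta)\cap\{z :
[\eta,[z,s]]=0\}=0$ for $s\in S_\tau$ (`IsTriple.eq_zero_of_lie_slice`, a highest weight argument).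
The Jacobian criterion `smooth_of_det_ne_zero` then gives smoothness. Since $df_i = \iota_{\tilde
z_i}\omega$, the same matrix gives nondegeneracy of the restricted form. -/

lemma commutation_mul_pow {R : Type*} [Ring R] {e f h : R} (hef : e * f = f * e + h)
    (hhf : h * f = f * h - 2 * f) (n : ℕ) :
    e * f ^ (n + 1) = f ^ (n + 1) * e + (n + 1) * (f ^ n * (h - n)) := by
  induction n with
  | zero => simpa using hef
  | succ n ih =>
    have h1 : e * f ^ (n + 1 + 1) = (f ^ (n + 1) * e + (n + 1) * (f ^ n * (h - n))) * f := by
      rw [pow_succ f (n + 1), ← mul_assoc, ih]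
    have hc : (n : R) * f = f * n := Nat.cast_comm n f
    have h2 : (h - n) * f = f * (h - n - 2) := by
      rw [sub_mul, hhf, hc]; noncomm_ring
    have h3 : (f ^ (n + 1) * e + (n + 1) * (f ^ n * (h - n))) * f =
        f ^ (n + 1) * (e * f) + (n + 1) * (f ^ n * ((h - n) * f)) := by noncomm_ring
    have hc' : (n : R) * f ^ (n + 1) = f ^ (n + 1) * n := Nat.cast_comm n _
    have h4 : f ^ n * (f * (h - n - 2)) = f ^ (n + 1) * (h - n - 2) := by
      rw [← mul_assoc, ← pow_succ]
    rw [h1, h3, h2, h4, hef, mul_add, ← mul_assoc, ← pow_succ, add_assoc]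
    congr 1
    push_cast
    have h5 : ((n : R) + 1) * (f ^ (n + 1) * (h - n - 2)) =
        f ^ (n + 1) * ((n + 1) * (h - n - 2)) := by
      rw [← mul_assoc, ← mul_assoc, add_mul, hc', mul_add, one_mul, mul_one]
    have h6 : ((n : R) + 1 + 1) * (f ^ (n + 1) * (h - (n + 1))) =
        f ^ (n + 1) * ((n + 1 + 1) * (h - (n + 1))) := by
      have h7 : ((n : R) + 1 + 1) * f ^ (n + 1) = f ^ (n + 1) * (n + 1 + 1) := by
        rw [add_mul, add_mul, hc', mul_add, mul_add, one_mul, mul_one]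
      rw [← mul_assoc, ← mul_assoc, h7]
    rw [h5, h6, ← mul_add]
    congr 1
    have h7 : (n : R) * h = h * n := Nat.cast_comm n h
    noncomm_ring

variable {V : Type*} [AddCommGroup V] [Module ℂ V] [FiniteDimensional ℂ V]

lemma exists_projections_maxGenEigenspace (T : Module.End ℂ V) :
    ∃ P : ℂ → V →ₗ[ℂ] V, (∀ c z, P c z ∈ T.maxGenEigenspace c) ∧
      (∀ c, ∀ z ∈ T.maxGenEigenspace c, P c z = z) ∧
      (∀ c d, c ≠ d → ∀ z ∈ T.maxGenEigenspace d, P c z = 0) ∧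
      ∃ E : Finset ℂ, (∀ c, c ∉ E → T.maxGenEigenspace c = ⊥) ∧ ∀ z, z = ∑ c ∈ E, P c z := by
  classical
  have hI : DirectSum.IsInternal (fun c : ℂ => T.maxGenEigenspace c) :=
    (DirectSum.isInternal_submodule_iff_iSupIndep_and_iSup_eq_top _).2
      ⟨T.independent_maxGenEigenspace, T.iSup_maxGenEigenspace_eq_top⟩
  let e := LinearEquiv.ofBijective (DirectSum.coeLinearMap fun c : ℂ => T.maxGenEigenspace c) hI
  let P : ℂ → V →ₗ[ℂ] V := fun c =>
    (T.maxGenEigenspace c).subtype ∘ₗ DirectSum.component ℂ ℂ _ c ∘ₗ e.symm.toLinearMap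
  have he : ∀ c (z : T.maxGenEigenspace c), e.symm z.1 = DirectSum.lof ℂ ℂ _ c z := by
    intro c z
    rw [LinearEquiv.symm_apply_eq]
    exact (DirectSum.coeLinearMap_lof _ c z).symm
  have hP0 : ∀ c z, P c z ∈ T.maxGenEigenspace c := fun c z => Subtype.prop _
  have hP1 : ∀ c, ∀ z ∈ T.maxGenEigenspace c, P c z = z := by
    intro c z hz
    change ((DirectSum.component ℂ ℂ _ c (e.symm z) : T.maxGenEigenspace c) : V) = z
    rw [he c ⟨z, hz⟩, DirectSum.component.lof_self]
  have hP2 : ∀ c d, c ≠ d → ∀ z ∈ T.maxGenEigenspace d, P c z = 0 := by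
    intro c d hcd z hz
    change ((DirectSum.component ℂ ℂ _ c (e.symm z) : T.maxGenEigenspace c) : V) = 0
    rw [he d ⟨z, hz⟩, DirectSum.component.of, dif_neg hcd.symm]
    rfl
  have hfin : {c | T.HasEigenvalue c}.Finite := T.finite_hasEigenvalue
  have hE : ∀ c, c ∉ hfin.toFinset → T.maxGenEigenspace c = ⊥ := by
    intro c hc
    by_contra hne
    apply hc
    rw [Set.Finite.mem_toFinset]
    exact (Module.End.hasUnifEigenvalue_iff_hasUnifEigenvalue_one (k := ⊤) (by simp)).1 hne
  refine ⟨P, hP0, hP1, hP2, hfin.toFinset, hE, ?_⟩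
  intro z
  have hz : z ∈ ⨆ c, T.maxGenEigenspace c := by
    rw [T.iSup_maxGenEigenspace_eq_top]; trivial
  induction hz using Submodule.iSup_induction' with
  | mem c x hx =>
    by_cases hc : c ∈ hfin.toFinset
    · rw [Finset.sum_eq_single c, hP1 c x hx]
      · intro b _ hb
        exact hP2 b c hb x hx
      · exact fun h => absurd hc h
    · rw [hE c hc, Submodule.mem_bot] at hx
      simp [hx]
  | zero => simp
  | add x y _ _ hx hy =>
    simp only [map_add, Finset.sum_add_distrib]
    rw [← hx, ← hy]

/-- An operator that shifts weights by `s` intertwines the weight projections with the same shift.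
This turns equations for a vector into equations for its weight components. -/
lemma map_projection_eq {T N : Module.End ℂ V} {P : ℂ → V →ₗ[ℂ] V}
    (hP1 : ∀ c, ∀ z ∈ T.maxGenEigenspace c, P c z = z)
    (hP2 : ∀ c d, c ≠ d → ∀ z ∈ T.maxGenEigenspace d, P c z = 0) {s : ℂ}
    (hN : ∀ c, ∀ z ∈ T.maxGenEigenspace c, N z ∈ T.maxGenEigenspace (s + c)) (c : ℂ) (z : V) :
    N (P c z) = P (s + c) (N z) := by
  have hz : z ∈ ⨆ c, T.maxGenEigenspace c := by
    rw [T.iSup_maxGenEigenspace_eq_top]; trivial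
  induction hz using Submodule.iSup_induction' with
  | mem d x hx =>
    by_cases hd : c = d
    · subst hd
      rw [hP1 c x hx, hP1 _ _ (hN c x hx)]
    · rw [hP2 c d hd x hx, hP2 (s + c) (s + d) (by simpa using hd) _ (hN d x hx), map_zero]
  | zero => simp
  | add x y _ _ hx hy => simp only [map_add, hx, hy]

/-- A kernel vector of `T - d` in `U` would lie in two distinct generalized eigenspaces, so `T - d`
is injective on `U`, hence onto. Using this in place of diagonalizability of `ad h` keeps the weight
arguments within generalized eigenspaces. -/
lemma exists_sub_smul_eq {T : Module.End ℂ V} {c d : ℂ} (hcd : c ≠ d) {U : Submodule ℂ V}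
    (hU : U ≤ T.maxGenEigenspace c) (hT : ∀ x ∈ U, T x ∈ U) {x : V} (hx : x ∈ U) :
    ∃ y ∈ U, T y - d • y = x := by
  let R : U →ₗ[ℂ] U := (T - d • LinearMap.id).restrict (by
    intro y hy
    exact U.sub_mem (hT y hy) (U.smul_mem d hy))
  have hR : Function.Injective R := by
    rw [← LinearMap.ker_eq_bot, LinearMap.ker_eq_bot']
    intro y hy
    have h1 : T y.1 - d • y.1 = 0 := congrArg Subtype.val hy
    have h2 : y.1 ∈ T.maxGenEigenspace d :=
      Module.End.eigenspace_le_maxGenEigenspace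
        (Module.End.mem_eigenspace_iff.2 (sub_eq_zero.1 h1))
    have h3 := (Module.End.disjoint_genEigenspace T hcd ⊤ ⊤).le_bot ⟨hU y.2, h2⟩
    exact Subtype.ext h3
  obtain ⟨y, hy⟩ := LinearMap.surjective_of_injective hR ⟨x, hx⟩
  exact ⟨y.1, y.2, congrArg Subtype.val hy⟩

/-- The weights `n * s + c` are pairwise distinct and only finitely many weight spaces are nonzero,
so some power of `N` lands in a zero space. -/
lemma pow_apply_eq_zero_of_mem_maxGenEigenspace {T N : Module.End ℂ V} {s : ℂ} (hs : s ≠ 0)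
    (hN : ∀ c, ∀ z ∈ T.maxGenEigenspace c, N z ∈ T.maxGenEigenspace (s + c)) (c : ℂ) :
    ∃ n : ℕ, ∀ z ∈ T.maxGenEigenspace c, (N ^ n) z = 0 := by
  obtain ⟨-, -, -, -, E, hE, -⟩ := exists_projections_maxGenEigenspace T
  have hinj : Function.Injective (fun n : ℕ => (n : ℂ) * s + c) := by
    intro m n hmn
    have : (m : ℂ) * s = n * s := by simpa using hmn
    exact_mod_cast mul_right_cancel₀ hs this
  obtain ⟨n, hn⟩ := Set.Infinite.exists_notMem_finset (Set.infinite_range_of_injective hinj) E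
  obtain ⟨⟨n, rfl⟩, hn⟩ := hn
  refine ⟨n, fun z hz => ?_⟩
  have key : ∀ m : ℕ, (N ^ m) z ∈ T.maxGenEigenspace ((m : ℂ) * s + c) := by
    intro m
    induction m with
    | zero => simpa using hz
    | succ m ih =>
      have := hN _ _ ih
      rw [pow_succ', Module.End.mul_apply]
      convert this using 2
      push_cast; ring
  have := key n
  rwa [hE _ hn, Submodule.mem_bot] at this

end Sl2

/-! ### Highest weight arguments and transversality for the adjoint action of a triple. -/

namespace IsTriple

variable {L : Type*} [LieRing L] {ξ h η : L}

lemma symm (t : IsTriple ξ h η) : IsTriple η (-h) ξ where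
  lie_e_f := by rw [← lie_skew, t.lie_e_f]
  lie_h_e := by rw [neg_lie, t.lie_h_f, neg_neg]
  lie_h_f := by rw [neg_lie, t.lie_h_e]

variable [LieAlgebra ℂ L]

lemma ad_mul_pow (t : IsTriple ξ h η) (n : ℕ) (x : L) :
    LieAlgebra.ad ℂ L ξ ((LieAlgebra.ad ℂ L η ^ (n + 1)) x) =
      (LieAlgebra.ad ℂ L η ^ (n + 1)) (LieAlgebra.ad ℂ L ξ x) +
        ((n : ℂ) + 1) • (LieAlgebra.ad ℂ L η ^ n) (LieAlgebra.ad ℂ L h x - (n : ℂ) • x) := by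
  have h1 : LieAlgebra.ad ℂ L ξ * LieAlgebra.ad ℂ L η =
      LieAlgebra.ad ℂ L η * LieAlgebra.ad ℂ L ξ + LieAlgebra.ad ℂ L h := by
    ext x
    change ⁅ξ, ⁅η, x⁆⁆ = ⁅η, ⁅ξ, x⁆⁆ + ⁅h, x⁆
    rw [leibniz_lie, t.lie_e_f, add_comm]
  have h2 : LieAlgebra.ad ℂ L h * LieAlgebra.ad ℂ L η =
      LieAlgebra.ad ℂ L η * LieAlgebra.ad ℂ L h - 2 * LieAlgebra.ad ℂ L η := by
    ext x
    change ⁅h, ⁅η, x⁆⁆ = ⁅η, ⁅h, x⁆⁆ - (2 : Module.End ℂ L) ⁅η, x⁆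
    rw [leibniz_lie, t.lie_h_f, two_smul, neg_lie, add_lie, Module.End.ofNat_apply, two_smul]
    abel
  have := congrArg (fun T : Module.End ℂ L => T x) (commutation_mul_pow h1 h2 n)
  simpa [Module.End.mul_apply, Nat.cast_smul_eq_nsmul, add_smul] using this

lemma lie_e_mem (t : IsTriple ξ h η) (c : ℂ) (z : L)
    (hz : z ∈ (LieAlgebra.ad ℂ L h).maxGenEigenspace c) :
    LieAlgebra.ad ℂ L ξ z ∈ (LieAlgebra.ad ℂ L h).maxGenEigenspace (2 + c) := by
  refine LieModule.lie_mem_maxGenEigenspace_toEnd (M := L) (x := h) ?_ hz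
  refine Module.End.eigenspace_le_maxGenEigenspace (Module.End.mem_eigenspace_iff.2 ?_)
  change ⁅h, ξ⁆ = _
  rw [t.lie_h_e, two_smul, two_smul]

lemma lie_f_mem (t : IsTriple ξ h η) (c : ℂ) (z : L)
    (hz : z ∈ (LieAlgebra.ad ℂ L h).maxGenEigenspace c) :
    LieAlgebra.ad ℂ L η z ∈ (LieAlgebra.ad ℂ L h).maxGenEigenspace (-2 + c) := by
  refine LieModule.lie_mem_maxGenEigenspace_toEnd (M := L) (x := h) ?_ hz
  refine Module.End.eigenspace_le_maxGenEigenspace (Module.End.mem_eigenspace_iff.2 ?_)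
  change ⁅h, η⁆ = _
  rw [t.lie_h_f, two_smul, neg_smul, two_smul]

variable [FiniteDimensional ℂ L]

/-- The weights of highest weight vectors are natural numbers. -/
lemma exists_nat_of_lie_e_eq_zero (t : IsTriple ξ h η) {c : ℂ} {v : L}
    (hv : v ∈ (LieAlgebra.ad ℂ L h).maxGenEigenspace c) (hev : ⁅ξ, v⁆ = 0) (hv0 : v ≠ 0) :
    ∃ n : ℕ, c = n := by
  by_contra! hc
  let U := (LieAlgebra.ad ℂ L h).maxGenEigenspace c ⊓ LinearMap.ker (LieAlgebra.ad ℂ L ξ)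
  have hUh : ∀ x ∈ U, LieAlgebra.ad ℂ L h x ∈ U := by
    rintro x ⟨hx1, hx2⟩
    refine ⟨Module.End.mapsTo_maxGenEigenspace_of_comm (Commute.refl _) c hx1, ?_⟩
    have hx2' : ⁅ξ, x⁆ = 0 := hx2
    change ⁅ξ, ⁅h, x⁆⁆ = 0
    rw [leibniz_lie, hx2', lie_zero, add_zero, ← lie_skew ξ h, t.lie_h_e, two_smul, neg_lie,
      add_lie, hx2']
    simp
  -- On `U` the commutation formula reads `ξ ηⁿ⁺¹ y = (n+1) ηⁿ (h - n) y`. As `c ≠ n`, the operator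
  -- `h - n` is onto on `U`, so vanishing of `ηⁿ⁺¹` on `U` forces vanishing of `ηⁿ`, down to `η⁰ =
  -- 1`.
  have main : ∀ n : ℕ, (∀ x ∈ U, (LieAlgebra.ad ℂ L η ^ n) x = 0) → v = 0 := by
    intro n
    induction n with
    | zero => intro H; simpa using H v ⟨hv, hev⟩
    | succ n ih =>
      intro H
      apply ih
      intro x hx
      obtain ⟨y, hy, rfl⟩ := exists_sub_smul_eq (hc n) inf_le_left hUh hx
      have h1 := t.ad_mul_pow n y
      rw [H y hy, map_zero, show LieAlgebra.ad ℂ L ξ y = 0 from hy.2, map_zero, zero_add] at h1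
      exact (smul_eq_zero.1 h1.symm).resolve_left (by exact_mod_cast n.succ_ne_zero)
  obtain ⟨n, hn⟩ := pow_apply_eq_zero_of_mem_maxGenEigenspace (by norm_num) t.lie_f_mem c
  exact hv0 (main n fun x hx => hn x hx.1)

lemma exists_nat_of_lie_f_eq_zero (t : IsTriple ξ h η) {c : ℂ} {v : L}
    (hv : v ∈ (LieAlgebra.ad ℂ L h).maxGenEigenspace c) (hev : ⁅η, v⁆ = 0) (hv0 : v ≠ 0) :
    ∃ n : ℕ, c = -n := by
  have hv' : v ∈ (LieAlgebra.ad ℂ L (-h)).maxGenEigenspace (-c) := by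
    have := Module.End.genEigenspace_le_smul (LieAlgebra.ad ℂ L h) c (-1) ⊤ hv
    simpa [Module.End.maxGenEigenspace] using this
  obtain ⟨n, hn⟩ := t.symm.exists_nat_of_lie_e_eq_zero hv' hev hv0
  exact ⟨n, by rw [← hn, neg_neg]⟩

/-- `ker(ad_ξ) ∩ im(ad_η) = 0`. -/
lemma eq_zero_of_lie_e_lie_f (t : IsTriple ξ h η) {a : L} (ha : ⁅ξ, ⁅η, a⁆⁆ = 0) :
    ⁅η, a⁆ = 0 := by
  obtain ⟨P, hP0, hP1, hP2, E, -, hE⟩ := exists_projections_maxGenEigenspace (LieAlgebra.ad ℂ L h)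
  have hPf := map_projection_eq hP1 hP2 t.lie_f_mem
  have hPe := map_projection_eq hP1 hP2 t.lie_e_mem
  suffices H : ∀ c, ∀ w ∈ (LieAlgebra.ad ℂ L h).maxGenEigenspace c, ⁅ξ, ⁅η, w⁆⁆ = 0 →
      ⁅η, w⁆ = 0 by
    rw [hE a, lie_sum]
    refine Finset.sum_eq_zero fun c _ => H c _ (hP0 c a) ?_
    have h1 : ⁅η, P c a⁆ = P (-2 + c) ⁅η, a⁆ := hPf c a
    have h2 : ⁅ξ, P (-2 + c) ⁅η, a⁆⁆ = P (2 + (-2 + c)) ⁅ξ, ⁅η, a⁆⁆ := hPe _ _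
    rw [h1, h2, ha, map_zero]
  intro c w hw hew
  by_contra hfw
  obtain ⟨m, hm⟩ := t.exists_nat_of_lie_e_eq_zero (t.lie_f_mem c w hw) hew hfw
  -- The vector `⁅η, w⁆` is a highest weight vector of weight `c - 2 = m`, so `c` is positive and
  -- never equals `-n`. This drives the descent below, now with `ξ` raising and the triple `(η, -h,
  -- ξ)`: the term `ξⁿ⁺¹ η y` vanishes since `ξ η y = 0`.
  have hc : c = m + 2 := by rw [← hm]; ring
  let U := (LieAlgebra.ad ℂ L h).maxGenEigenspace c ⊓
    LinearMap.ker (LieAlgebra.ad ℂ L ξ * LieAlgebra.ad ℂ L η)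
  have hUh : ∀ x ∈ U, LieAlgebra.ad ℂ L h x ∈ U := by
    rintro x ⟨hx1, hx2⟩
    refine ⟨Module.End.mapsTo_maxGenEigenspace_of_comm (Commute.refl _) c hx1, ?_⟩
    have hx2' : ⁅ξ, ⁅η, x⁆⁆ = 0 := hx2
    change ⁅ξ, ⁅η, ⁅h, x⁆⁆⁆ = 0
    have h1 : ⁅η, ⁅h, x⁆⁆ = ⁅h, ⁅η, x⁆⁆ + (2 : ℕ) • ⁅η, x⁆ := by
      rw [leibniz_lie η h x, ← lie_skew η h, t.lie_h_f, neg_neg, two_smul, two_smul, add_lie,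
        add_comm]
    rw [h1, lie_add, two_smul, lie_add, hx2', leibniz_lie ξ h, hx2', ← lie_skew ξ h, t.lie_h_e,
      two_smul, neg_lie, add_lie, hx2']
    simp
  have main : ∀ n : ℕ, (∀ x ∈ U, (LieAlgebra.ad ℂ L ξ ^ n) x = 0) → w = 0 := by
    intro n
    induction n with
    | zero => intro H; simpa using H w ⟨hw, hew⟩
    | succ n ih =>
      intro H
      apply ih
      intro x hx
      have hne : c ≠ (-n : ℂ) := by
        rw [hc]
        intro h0
        have : ((m + 2 + n : ℕ) : ℂ) = 0 := by push_cast; rw [h0]; ring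
        have := Nat.cast_eq_zero.1 this
        omega
      obtain ⟨y, hy, rfl⟩ := exists_sub_smul_eq hne inf_le_left hUh hx
      have h1 := t.symm.ad_mul_pow n y
      have h2 : (LieAlgebra.ad ℂ L ξ ^ (n + 1)) (LieAlgebra.ad ℂ L η y) = 0 := by
        have hy2 : LieAlgebra.ad ℂ L ξ (LieAlgebra.ad ℂ L η y) = 0 := hy.2
        rw [pow_succ, Module.End.mul_apply, hy2, map_zero]
      rw [H y hy, map_zero, h2, zero_add] at h1
      have h3 := (smul_eq_zero.1 h1.symm).resolve_left (by exact_mod_cast n.succ_ne_zero)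
      rw [map_neg, LinearMap.neg_apply] at h3
      rw [neg_smul, sub_neg_eq_add]
      rw [← neg_add', map_neg, neg_eq_zero] at h3
      exact h3
  obtain ⟨n, hn⟩ := pow_apply_eq_zero_of_mem_maxGenEigenspace (by norm_num) t.lie_e_mem c
  refine hfw ?_
  rw [main n fun x hx => hn x hx.1, lie_zero]

/-- Transversality of the Slodowy slice to the adjoint orbits. -/
lemma eq_zero_of_lie_slice (t : IsTriple ξ h η) {s a : L} (hs : s ∈ slodowySlice ξ η)
    (ha : ⁅η, ⁅⁅η, a⁆, s⁆⁆ = 0) : ⁅η, a⁆ = 0 := by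
  classical
  obtain ⟨k, hk, rfl⟩ := hs
  obtain ⟨P, hP0, hP1, hP2, E, -, hE⟩ := exists_projections_maxGenEigenspace (LieAlgebra.ad ℂ L h)
  have hPf : ∀ c z, ⁅η, P c z⁆ = P (-2 + c) ⁅η, z⁆ := map_projection_eq hP1 hP2 t.lie_f_mem
  have hPe : ∀ c z, ⁅ξ, P c z⁆ = P (2 + c) ⁅ξ, z⁆ := map_projection_eq hP1 hP2 t.lie_e_mem
  by_contra hz
  set z := ⁅η, a⁆ with hzdef
  -- Take a nonzero component of `z` whose weight has maximal real part; weights are a priori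
  -- arbitrary complex numbers.
  obtain ⟨c, hc, hmax⟩ := Finset.exists_max_image (E.filter fun c => P c z ≠ 0) Complex.re (by
    by_contra hne
    rw [Finset.not_nonempty_iff_eq_empty, Finset.filter_eq_empty_iff] at hne
    apply hz
    rw [hE z]
    exact Finset.sum_eq_zero fun c hc => not_not.1 (hne hc))
  -- As `η` kills `k`, all weights of `k` are of the form `-n`; hence `⁅k, z⁆` has no weight of real
  -- part above that of `c`, and the component of `⁅z, ξ + k⁆` in weight `c + 2` comes from `ξ`
  -- alone.
  have hkz : P (2 + c) ⁅k, z⁆ = 0 := by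
    rw [hE k, hE z, sum_lie, map_sum]
    refine Finset.sum_eq_zero fun α _ => ?_
    rw [lie_sum, map_sum]
    refine Finset.sum_eq_zero fun β hβ => ?_
    by_cases h1 : P α k = 0
    · rw [h1, zero_lie, map_zero]
    by_cases h2 : P β z = 0
    · rw [h2, lie_zero, map_zero]
    refine hP2 _ (α + β) ?_ _
      (LieModule.lie_mem_maxGenEigenspace_toEnd (M := L) (hP0 α k) (hP0 β z))
    intro h3
    obtain ⟨n, hn⟩ := t.exists_nat_of_lie_f_eq_zero (hP0 α k) (by rw [hPf, hk, map_zero]) h1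
    have h4 := hmax β (Finset.mem_filter.2 ⟨hβ, h2⟩)
    have h5 := congrArg Complex.re h3
    rw [hn] at h5
    simp only [Complex.add_re, Complex.neg_re, Complex.natCast_re, Complex.re_ofNat] at h5
    have h6 : (0 : ℝ) ≤ n := n.cast_nonneg
    linarith
  have h1 : ⁅η, ⁅ξ, P c z⁆⁆ = 0 := by
    have h2 : P (2 + c) ⁅z, ξ + k⁆ = -⁅ξ, P c z⁆ := by
      rw [lie_add, map_add, ← lie_skew z ξ, ← lie_skew z k, map_neg, map_neg, hkz, hPe]; simp
    have h3 := hPf (2 + c) ⁅z, ξ + k⁆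
    rw [ha, map_zero, h2, lie_neg, neg_eq_zero] at h3
    exact h3
  -- The intersection lemma is used twice: first `ker η ∩ im ξ = 0` kills `⁅ξ, P c z⁆`, then `ker ξ
  -- ∩ im η = 0` kills `P c z`, which is in `im η` because `z` is.
  have h2 : ⁅ξ, P c z⁆ = 0 := t.symm.eq_zero_of_lie_e_lie_f h1
  have h3 : P c z = ⁅η, P (2 + c) a⁆ := by rw [hPf, hzdef]; congr 2; ring
  rw [h3] at h2
  exact (Finset.mem_filter.1 hc).2 (h3.trans (t.eq_zero_of_lie_e_lie_f h2))

end IsTriple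

/-! ### Smooth algebras in characteristic zero: reducedness and the Jacobian criterion. -/

section CommAlg

/-- Starting from `xⁿ = 0`, differentiating `x ^ (n - k) * D x ^ (2 * k) = 0` and multiplying by `D
x` trades one factor `x` for two factors `D x`; the integer that appears is invertible over `ℚ`. -/
lemma derivation_apply_isNilpotent {R B : Type*} [CommRing R] [CommRing B] [Algebra R B]
    [Algebra ℚ B] (D : Derivation R B B) {x : B} (hx : IsNilpotent x) : IsNilpotent (D x) := by
  obtain ⟨n, hn⟩ := hx
  have key : ∀ k ≤ n, x ^ (n - k) * D x ^ (2 * k) = 0 := by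
    intro k
    induction k with
    | zero => intro _; simpa using hn
    | succ k ih =>
      intro hk
      have h1 := ih (by omega)
      obtain ⟨j, hj⟩ : ∃ j, n - k = j + 1 := ⟨n - k - 1, by omega⟩
      have hj' : n - (k + 1) = j := by omega
      rw [hj] at h1
      rw [hj']
      have h2 : D x * D (x ^ (j + 1) * D x ^ (2 * k)) = 0 := by rw [h1, map_zero, mul_zero]
      have h3 : D x * (x ^ (j + 1) * D (D x ^ (2 * k))) = 0 := by
        rcases Nat.eq_zero_or_pos k with rfl | hk0
        · simp
        · obtain ⟨i, hi⟩ : ∃ i, 2 * k = i + 1 := ⟨2 * k - 1, by omega⟩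
          rw [Derivation.leibniz_pow, hi]
          rw [hi] at h1
          simp only [Nat.add_sub_cancel, smul_eq_mul, nsmul_eq_mul]
          linear_combination (((i + 1 : ℕ) : B) * D (D x)) * h1
      rw [Derivation.leibniz, Derivation.leibniz_pow D (a := x)] at h2
      simp only [Nat.add_sub_cancel, smul_eq_mul, nsmul_eq_mul] at h2
      have h4 : ((j + 1 : ℕ) : B) * (x ^ j * D x ^ (2 * (k + 1))) = 0 := by
        linear_combination h2 - h3
      have h5 : IsUnit ((j + 1 : ℕ) : B) := by
        have : IsUnit (((j + 1 : ℕ) : ℚ)) := by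
          rw [isUnit_iff_ne_zero]; exact_mod_cast j.succ_ne_zero
        simpa using this.map (algebraMap ℚ B)
      exact (h5.mul_right_eq_zero).1 h4
  exact ⟨2 * n, by simpa using key n le_rfl⟩

/-- A derivation that is congruent to the identity on `m` modulo `m ^ 2` acts on
`m ^ k / m ^ (k + 1)` as multiplication by `k`. -/
lemma derivation_sub_mul_mem_pow {R B : Type*} [CommRing R] [CommRing B] [Algebra R B]
    {m : Ideal B} {D : Derivation R B B} (hD : ∀ y ∈ m, D y - y ∈ m ^ 2) (k : ℕ) {x : B}
    (hx : x ∈ m ^ (k + 1)) : D x - (k + 1 : B) * x ∈ m ^ (k + 2) := by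
  induction k generalizing x with
  | zero => simpa using hD x (by simpa using hx)
  | succ k ih =>
    rw [pow_succ'] at hx
    induction hx using Submodule.mul_induction_on' with
    | mem_mul_mem y hy z hz =>
      have h1 : D (y * z) - ((k + 1 : ℕ) + 1 : B) * (y * z) =
          y * (D z - (k + 1 : B) * z) + (D y - y) * z := by
        rw [Derivation.leibniz, smul_eq_mul, smul_eq_mul]; push_cast; ring
      rw [h1]
      refine add_mem ?_ ?_
      · rw [pow_succ']
        exact Ideal.mul_mem_mul hy (ih hz)
      · have := Ideal.mul_mem_mul (hD y hy) hz
        rwa [← pow_add, show 2 + (k + 1) = k + 1 + 2 by ring] at this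
    | add x _ y _ hx hy =>
      have h1 : D (x + y) - ((k + 1 : ℕ) + 1 : B) * (x + y) =
          (D x - ((k + 1 : ℕ) + 1 : B) * x) + (D y - ((k + 1 : ℕ) + 1 : B) * y) := by
        rw [map_add]; ring
      rw [h1]
      exact add_mem hx hy

/-- On a formally smooth algebra, there are coordinate vector fields at each rational point. -/
lemma exists_derivations_of_formallySmooth {k : Type u} {B : Type v} [Field k] [CommRing B]
    [Algebra k B] [Algebra.FormallySmooth k B] (ev : B →ₐ[k] k) {n : ℕ} (t : Fin n → B)
    (ht : Ideal.span (Set.range t) = RingHom.ker ev) :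
    ∃ D : Fin n → Derivation k B B, ∀ y ∈ RingHom.ker ev,
      ∑ i, t i * D i y - y ∈ RingHom.ker ev ^ 2 := by
  set m := RingHom.ker ev with hm
  have hmem : ∀ b, b - algebraMap k B (ev b) ∈ m := by
    intro b
    rw [hm, RingHom.mem_ker, map_sub, AlgHom.commutes]
    exact sub_self _
  let d : Derivation k B m.Cotangent :=
    Derivation.mk'
      { toFun := fun b => m.toCotangent ⟨b - algebraMap k B (ev b), hmem b⟩
        map_add' := by
          intro a b
          rw [← map_add]
          congr 1
          apply Subtype.ext
          simp only [map_add, Submodule.coe_add]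
          ring
        map_smul' := by
          intro c b
          refine Eq.trans ?_ (algebraMap_smul B c (m.toCotangent ⟨_, hmem b⟩))
          rw [← map_smul]
          congr 1
          apply Subtype.ext
          simp only [Algebra.smul_def, map_mul, AlgHom.commutes, Submodule.coe_smul,
            RingHom.id_apply, Algebra.algebraMap_self]
          ring }
      (by
        intro a b
        change m.toCotangent _ = a • m.toCotangent _ + b • m.toCotangent _
        rw [← map_smul, ← map_smul, ← map_add, Ideal.toCotangent_eq]
        simp only [Submodule.coe_add, Submodule.coe_smul, smul_eq_mul, map_mul]
        have := neg_mem (Ideal.mul_mem_mul (hmem a) (hmem b))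
        rw [← pow_two] at this
        convert this using 1
        ring)
  let q : (Fin n → B) →ₗ[B] m :=
    LinearMap.codRestrict m (Fintype.linearCombination B t) (by
      intro c
      rw [Fintype.linearCombination_apply]
      refine sum_mem fun i _ => m.mul_mem_left _ ?_
      rw [← ht]
      exact Ideal.subset_span ⟨i, rfl⟩)
  have hq : Function.Surjective q := by
    rintro ⟨x, hx⟩
    rw [← ht] at hx
    obtain ⟨c, hc⟩ := (Ideal.mem_span_range_iff_exists_fun).1 hx
    refine ⟨c, Subtype.ext ?_⟩
    change Fintype.linearCombination B t c = x
    rw [Fintype.linearCombination_apply]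
    exact hc
  -- Formal smoothness makes the Kähler differentials projective, so the derivation `d` into `m /
  -- m²` lifts through `Bⁿ → m → m / m²`. The coordinates of the lift are the required derivations.
  obtain ⟨l, hl⟩ := Module.projective_lifting_property (m.toCotangent ∘ₗ q) d.liftKaehlerDifferential
    (m.toCotangent_surjective.comp hq)
  refine ⟨fun i => (LinearMap.proj i ∘ₗ l).compDer (KaehlerDifferential.D k B), ?_⟩
  intro y hy
  have h1 := congrArg (fun f : _ →ₗ[B] m.Cotangent => f (KaehlerDifferential.D k B y)) hl
  simp only [LinearMap.comp_apply, Derivation.liftKaehlerDifferential_comp_D] at h1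
  change m.toCotangent _ = m.toCotangent _ at h1
  rw [Ideal.toCotangent_eq] at h1
  have h0 : ev y = 0 := hy
  have h2 : ((q (l (KaehlerDifferential.D k B y)) : m) : B) =
      ∑ i, t i * l (KaehlerDifferential.D k B y) i := by
    change Fintype.linearCombination B t _ = _
    rw [Fintype.linearCombination_apply]
    exact Finset.sum_congr rfl fun i _ => mul_comm _ _
  rw [h2] at h1
  simpa [h0] using h1

lemma exists_algHom_ker_eq {B : Type v} [CommRing B] [Algebra ℂ B] [Algebra.FiniteType ℂ B]
    (m : Ideal B) [m.IsMaximal] : ∃ ev : B →ₐ[ℂ] ℂ, RingHom.ker ev = m := by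
  let := Ideal.Quotient.field m
  have : Module.Finite ℂ (B ⧸ m) := finite_of_finite_type_of_isJacobsonRing ℂ (B ⧸ m)
  let e : ℂ ≃ₐ[ℂ] (B ⧸ m) := AlgEquiv.ofBijective (Algebra.ofId ℂ (B ⧸ m))
    IsAlgClosed.algebraMap_bijective_of_isIntegral
  refine ⟨e.symm.toAlgHom.comp (Ideal.Quotient.mkₐ ℂ m), ?_⟩
  ext x
  rw [RingHom.mem_ker]
  change e.symm (Ideal.Quotient.mk m x) = 0 ↔ _
  rw [EmbeddingLike.map_eq_zero_iff, Ideal.Quotient.eq_zero_iff_mem]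

/-- At each maximal ideal `m`, the Euler-type derivation `E = ∑ tᵢ Dᵢ` multiplies `m ^ k / m ^ (k +
1)` by `k`. For a nilpotent `x ∈ m ^ k` the `Dᵢ x` are again nilpotent; knowing inductively that all
nilpotents lie in `m ^ k` gives `E x ∈ m ^ (k + 1)`, hence `x ∈ m ^ (k + 1)`. So nilpotents lie in
every power of every maximal ideal. -/
lemma isReduced_of_formallySmooth {B : Type v} [CommRing B] [Algebra ℂ B]
    [Algebra.FiniteType ℂ B] [Algebra.FormallySmooth ℂ B] : IsReduced B := by
  have : IsNoetherianRing B := Algebra.FiniteType.isNoetherianRing ℂ B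
  let : Algebra ℚ B := ((algebraMap ℂ B).comp (algebraMap ℚ ℂ)).toAlgebra
  have key : ∀ m : Ideal B, m.IsMaximal → ∀ k : ℕ, ∀ x : B, IsNilpotent x → x ∈ m ^ (k + 1) := by
    intro m hm k
    obtain ⟨ev, hev⟩ := exists_algHom_ker_eq m
    obtain ⟨n, t, ht⟩ := Submodule.fg_iff_exists_fin_generating_family.1 (IsNoetherian.noetherian m)
    obtain ⟨D, hD⟩ := exists_derivations_of_formallySmooth ev t (ht.trans hev.symm)
    rw [hev] at hD
    have htm : ∀ i, t i ∈ m := fun i => by rw [← ht]; exact Submodule.subset_span ⟨i, rfl⟩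
    induction k with
    | zero =>
      intro x hx
      rw [zero_add, pow_one]
      obtain ⟨n, hn⟩ := hx
      exact hm.isPrime.mem_of_pow_mem n (hn ▸ m.zero_mem)
    | succ k ih =>
      intro x hx
      let E : Derivation ℂ B B := ∑ i, t i • D i
      have hE : ∀ y, E y = ∑ i, t i * D i y := by
        intro y
        change Derivation.coeFnAddMonoidHom (∑ i, t i • D i) y = _
        rw [map_sum, Finset.sum_apply]
        rfl
      have h1 := derivation_sub_mul_mem_pow (D := E) (m := m)
        (fun y hy => by rw [hE]; exact hD y hy) k (ih x hx)
      have h2 : E x ∈ m ^ (k + 2) := by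
        rw [hE]
        refine sum_mem fun i _ => ?_
        rw [pow_succ']
        exact Ideal.mul_mem_mul (htm i) (ih _ (derivation_apply_isNilpotent (D i) hx))
      have h3 : ((k + 1 : ℕ) : B) * x ∈ m ^ (k + 2) := by
        have := sub_mem h2 h1
        push_cast
        simpa using this
      have h5 : IsUnit ((k + 1 : ℕ) : B) := by
        have : IsUnit (((k + 1 : ℕ) : ℚ)) := by
          rw [isUnit_iff_ne_zero]; exact_mod_cast k.succ_ne_zero
        simpa using this.map (algebraMap ℚ B)
      exact (Ideal.unit_mul_mem_iff_mem _ h5).1 h3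
  refine ⟨fun x hx => ?_⟩
  by_contra hx0
  -- Choose `m` above the annihilator of `x`. Krull's intersection theorem gives `r ∈ m` with `r * x
  -- = x`, so `1 - r` annihilates `x` and lies in `m` as well, a contradiction.
  let a : Ideal B := Ideal.span {x} |>.annihilator
  have ha : a ≠ ⊤ := by
    intro h
    have : (1 : B) ∈ a := h ▸ Submodule.mem_top
    have := Submodule.mem_annihilator.1 this x (Ideal.mem_span_singleton_self x)
    exact hx0 (by simpa using this)
  obtain ⟨m, hm, ham⟩ := Ideal.exists_le_maximal a ha
  have h1 : x ∈ (⨅ i : ℕ, m ^ i • (⊤ : Submodule B B)) := by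
    rw [Submodule.mem_iInf]
    intro i
    rw [smul_eq_mul, Ideal.mul_top]
    exact Ideal.pow_le_pow_right (Nat.le_succ i) (key m hm i x hx)
  obtain ⟨r, hr⟩ := (Ideal.mem_iInf_smul_pow_eq_bot_iff m x).1 h1
  have h2 : (1 - r.1) ∈ m := by
    apply ham
    rw [Submodule.mem_annihilator]
    intro y hy
    obtain ⟨b, rfl⟩ := Ideal.mem_span_singleton'.1 hy
    have hr' : r.1 * x = x := hr
    rw [smul_eq_mul]
    linear_combination -b * hr'
  exact hm.ne_top ((Ideal.eq_top_iff_one m).2 (by simpa using add_mem h2 r.2))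

/-- In a finitely generated smooth `ℂ`-algebra, a function is determined by its values. -/
lemma eq_zero_of_forall_algHom {B : Type v} [CommRing B] [Algebra ℂ B] [Algebra.FiniteType ℂ B]
    [IsReduced B] {x : B} (hx : ∀ ev : B →ₐ[ℂ] ℂ, ev x = 0) : x = 0 := by
  have : IsJacobsonRing B := isJacobsonRing_of_finiteType (A := ℂ)
  have h1 : x ∈ (⊥ : Ideal B).jacobson := by
    rw [Ideal.jacobson, Submodule.mem_sInf]
    rintro m ⟨-, hm⟩
    obtain ⟨ev, hev⟩ := exists_algHom_ker_eq m
    rw [← hev]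
    exact hx ev
  have h2 : (⊥ : Ideal B).IsRadical := by
    intro y hy
    obtain ⟨n, hn⟩ := hy
    exact IsReduced.eq_zero y ⟨n, hn⟩
  rw [this.out h2] at h1
  exact h1

/-- The Jacobian criterion, with derivations dual to the generators of the ideal. -/
lemma formallySmooth_quotient {k : Type u} {A : Type v} [CommRing k] [CommRing A] [Algebra k A]
    [Algebra.FormallySmooth k A] {n : ℕ} (f : Fin n → A) (D : Fin n → Derivation k A A)
    (J : Ideal A) (hJ : J = Ideal.span (Set.range f))
    (hD : ∀ i j, D i (f j) - (if i = j then 1 else 0) ∈ J) :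
    Algebra.FormallySmooth k (A ⧸ J) := by
  let π : A →ₐ[k] A ⧸ J := Ideal.Quotient.mkₐ k J
  have hker : RingHom.ker π.toRingHom = J := Ideal.Quotient.mkₐ_ker k J
  let K := RingHom.ker π.toRingHom
  have hf : ∀ i, f i ∈ J := fun i => hJ ▸ Ideal.subset_span ⟨i, rfl⟩
  have hsum : ∀ c : Fin n → A, ∑ i, c i * f i ∈ J := fun c =>
    sum_mem fun i _ => J.mul_mem_left _ (hf i)
  -- First-order Taylor correction along the `f i`: modulo `J²` it is multiplicative, since the
  -- defect is a product of two elements of `J`, and it kills `J` because the `D i` are dual to the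
  -- `f i` modulo `J`. It therefore splits `A / J² → A / J`.
  let ψ : A →ₗ[k] A :=
    LinearMap.id - ∑ i, LinearMap.mulRight k (f i) ∘ₗ (D i : A →ₗ[k] A)
  have e : ∀ a, ψ a = a - ∑ i, D i a * f i := by
    intro a
    simp [ψ, LinearMap.sum_apply]
  let φ : A →ₐ[k] A ⧸ K ^ 2 := AlgHom.ofLinearMap
    ((Ideal.Quotient.mkₐ k (K ^ 2)).toLinearMap ∘ₗ ψ)
    (by simp [e])
    (by
      intro a b
      simp only [LinearMap.comp_apply, e, AlgHom.toLinearMap_apply]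
      rw [← map_mul, Ideal.Quotient.mkₐ_eq_mk, Ideal.Quotient.eq]
      have h1 : ∑ i, D i (a * b) * f i = a * (∑ i, D i b * f i) + b * (∑ i, D i a * f i) := by
        rw [Finset.mul_sum, Finset.mul_sum, ← Finset.sum_add_distrib]
        refine Finset.sum_congr rfl fun i _ => ?_
        rw [Derivation.leibniz, smul_eq_mul, smul_eq_mul]; ring
      have h2 := neg_mem (Ideal.mul_mem_mul (hsum fun i => D i a) (hsum fun i => D i b))
      rw [← pow_two] at h2
      change _ ∈ RingHom.ker π.toRingHom ^ 2
      rw [hker]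
      convert h2 using 1
      rw [h1]; ring)
  have hφ : ∀ a, φ a = Ideal.Quotient.mk (K ^ 2) (a - ∑ i, D i a * f i) := by
    intro a
    change Ideal.Quotient.mk (K ^ 2) (ψ a) = _
    rw [e]
  have hφJ : ∀ a ∈ J, φ a = 0 := by
    intro a ha
    have hfk : ∀ j, φ (f j) = 0 := by
      intro j
      rw [hφ, Ideal.Quotient.eq_zero_iff_mem]
      change _ ∈ RingHom.ker π.toRingHom ^ 2
      rw [hker]
      have h1 : f j - ∑ i, D i (f j) * f i =
          - ∑ i, (D i (f j) - (if i = j then 1 else 0)) * f i := by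
        simp [sub_mul, Finset.sum_sub_distrib]
      rw [h1, pow_two]
      exact neg_mem (sum_mem fun i _ => Ideal.mul_mem_mul (hD i j) (hf i))
    rw [hJ] at ha
    obtain ⟨c, rfl⟩ := Ideal.mem_span_range_iff_exists_fun.1 ha
    simp [hfk]
  refine Algebra.FormallySmooth.of_split π (Ideal.Quotient.liftₐ J φ hφJ) ?_
  refine Ideal.Quotient.algHom_ext _ ?_
  refine AlgHom.ext fun a => ?_
  simp only [AlgHom.comp_apply]
  have h3 : Ideal.Quotient.liftₐ J φ hφJ (Ideal.Quotient.mkₐ k J a) = φ a := rfl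
  rw [h3, hφ]
  change π (a - ∑ i, D i a * f i) = π a
  have h4 : π (∑ i, D i a * f i) = 0 := Ideal.Quotient.eq_zero_iff_mem.2 (hsum _)
  rw [map_sub, h4, sub_zero]

end CommAlg

/-! ### Tangent spaces of varieties and of products. -/

section Tangents

variable {X : Type u} {Y : Type v} {Z : Type w} [HasRegularFunctions X] [HasRegularFunctions Y]
  [HasRegularFunctions Z]

lemma CoordRing.ext {f g : CoordRing X} (h : ∀ x, f.1 x = g.1 x) : f = g :=
  Subtype.ext (funext h)

lemma tangent_map_mul {p : X} (v : Tangent p) (f g : CoordRing X) :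
    v.1 (f * g) = f.1 p * v.1 g + g.1 p * v.1 f := v.2 f g

lemma tangent_map_algebraMap {p : X} (v : Tangent p) (c : ℂ) :
    v.1 (algebraMap ℂ (CoordRing X) c) = 0 := by
  have h1 : v.1 1 = 0 := by
    have := tangent_map_mul v 1 1
    have h2 : (1 : CoordRing X).1 p = 1 := rfl
    rw [mul_one, h2] at this
    linear_combination -this
  rw [Algebra.algebraMap_eq_smul_one, map_smul, h1, smul_zero]

instance finiteDimensional_tangent [IsAffineVariety X] (p : X) :
    FiniteDimensional ℂ (Tangent p) := by
  obtain ⟨s, hs⟩ := (IsAffineVariety.finiteType (X := X)).out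
  let e : Tangent p →ₗ[ℂ] (s → ℂ) :=
    { toFun := fun v i => v.1 i.1
      map_add' := fun _ _ => rfl
      map_smul' := fun _ _ => rfl }
  refine FiniteDimensional.of_injective e ?_
  rw [← LinearMap.ker_eq_bot, LinearMap.ker_eq_bot']
  intro v hv
  refine Subtype.ext (LinearMap.ext fun f => ?_)
  have hf : f ∈ Algebra.adjoin ℂ (s : Set (CoordRing X)) := hs ▸ Algebra.mem_top
  change v.1 f = 0
  induction hf using Algebra.adjoin_induction with
  | mem f hf => exact congrFun hv ⟨f, hf⟩
  | algebraMap c => exact tangent_map_algebraMap v c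
  | add f g _ _ hf hg => rw [map_add, hf, hg, add_zero]
  | mul f g _ _ hf hg => rw [tangent_map_mul v, hf, hg, mul_zero, mul_zero, add_zero]

lemma exists_sum_of_mem_coordRing_prod {F : X × Y → ℂ}
    (hF : F ∈ HasRegularFunctions.coordRing (X := X × Y)) :
    ∃ s : Finset (CoordRing X × CoordRing Y),
      ∀ x y, F (x, y) = ∑ i ∈ s, i.1.1 x * i.2.1 y := by
  obtain ⟨t, rfl⟩ := hF
  obtain ⟨s, rfl⟩ := TensorProduct.exists_finset t
  refine ⟨s, fun x y => ?_⟩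
  simp only [AlgHom.toRingHom_eq_coe, RingHom.coe_coe, map_sum,
    Algebra.TensorProduct.productMap_apply_tmul, Finset.sum_apply]
  rfl

/-- The first component of a tangent vector of a product. -/
def tangentFst {p : X × Y} : Tangent p →ₗ[ℂ] Tangent p.1 := (fst X Y).differential p

/-- The second component of a tangent vector of a product. -/
def tangentSnd {p : X × Y} : Tangent p →ₗ[ℂ] Tangent p.2 := (snd X Y).differential p

/-- A tangent vector of a product is the sum of its components. -/
lemma tangent_prod_apply {p : X × Y} (v : Tangent p) (F : CoordRing (X × Y)) :
    v.1 F = (tangentFst v).1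
        (((Morphism.id X).prodMk (Morphism.const X p.2)).pullback F) +
      (tangentSnd v).1
        (((Morphism.const Y p.1).prodMk (Morphism.id Y)).pullback F) := by
  obtain ⟨F, hF⟩ := F
  obtain ⟨s, hs⟩ := exists_sum_of_mem_coordRing_prod hF
  have h1 : (⟨F, hF⟩ : CoordRing (X × Y)) =
      ∑ i ∈ s, (fst X Y).pullback i.1 * (snd X Y).pullback i.2 := by
    refine CoordRing.ext fun q => ?_
    rw [AddSubmonoidClass.coe_finsetSum, Finset.sum_apply]
    exact hs q.1 q.2
  have h2 : ((Morphism.id X).prodMk (Morphism.const X p.2)).pullback ⟨F, hF⟩ =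
      ∑ i ∈ s, (i.2.1 p.2) • i.1 := by
    refine CoordRing.ext fun x => ?_
    rw [AddSubmonoidClass.coe_finsetSum, Finset.sum_apply]
    exact (hs x p.2).trans (Finset.sum_congr rfl fun i _ => mul_comm _ _)
  have h3 : ((Morphism.const Y p.1).prodMk (Morphism.id Y)).pullback ⟨F, hF⟩ =
      ∑ i ∈ s, (i.1.1 p.1) • i.2 := by
    refine CoordRing.ext fun y => ?_
    rw [AddSubmonoidClass.coe_finsetSum, Finset.sum_apply]
    exact hs p.1 y
  rw [h2, h3, h1, map_sum, map_sum, map_sum, ← Finset.sum_add_distrib]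
  refine Finset.sum_congr rfl fun i _ => ?_
  rw [tangent_map_mul v, map_smul, map_smul, add_comm]
  rfl

end Tangents

/-! ### The Lie algebra of the group and the derivative of the adjoint action. -/

section GroupLie

variable {G : Type u} [Group G] [HasRegularFunctions G] [IsAlgebraicGroup G]

lemma LieAlg.apply_apply (D : LieAlg G) (f : CoordRing G) (g : G) :
    (D.1 f).1 g = D.toTangent.1 ((leftMul g).pullback f) := by
  change _ = (D.1 ((leftMul g).pullback f)).1 1
  rw [D.2 g f]
  change _ = (D.1 f).1 (g * 1)
  rw [mul_one]

lemma LieAlg.toTangent_injective :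
    Function.Injective (LieAlg.toTangent : LieAlg G → Tangent (1 : G)) := by
  intro D E h
  refine Subtype.ext (Derivation.ext fun f => CoordRing.ext fun g => ?_)
  rw [LieAlg.apply_apply, LieAlg.apply_apply, h]

instance finiteDimensional_lieAlg : FiniteDimensional ℂ (LieAlg G) :=
  FiniteDimensional.of_injective
    ({ toFun := LieAlg.toTangent, map_add' := fun _ _ => rfl, map_smul' := fun _ _ => rfl } :
      LieAlg G →ₗ[ℂ] Tangent (1 : G)) LieAlg.toTangent_injective

/-- The inversion morphism. -/
def invMor (G : Type u) [Group G] [HasRegularFunctions G] [IsAlgebraicGroup G] : Morphism G G :=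
  ⟨fun g => g⁻¹, IsAlgebraicGroup.inv_regular⟩

lemma exists_comultiplication (f : CoordRing G) :
    ∃ s : Finset (CoordRing G × CoordRing G), ∀ g h, f.1 (g * h) = ∑ i ∈ s, i.1.1 g * i.2.1 h :=
  exists_sum_of_mem_coordRing_prod (IsAlgebraicGroup.mul_regular f)

/-- Expand the constant function `f (g * g⁻¹)` by the comultiplication and apply `v` with the
Leibniz rule. -/
lemma tangent_pullback_invMor (v : Tangent (1 : G)) (f : CoordRing G) :
    v.1 ((invMor G).pullback f) = -v.1 f := by
  obtain ⟨s, hs⟩ := exists_comultiplication f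
  have h1 : ∑ i ∈ s, i.1 * (invMor G).pullback i.2 = algebraMap ℂ (CoordRing G) (f.1 1) := by
    refine CoordRing.ext fun g => ?_
    rw [AddSubmonoidClass.coe_finsetSum, Finset.sum_apply]
    refine (hs g g⁻¹).symm.trans ?_
    rw [mul_inv_cancel]
    rfl
  have h2 : (invMor G).pullback f = ∑ i ∈ s, i.1.1 1 • (invMor G).pullback i.2 := by
    refine CoordRing.ext fun g => ?_
    rw [AddSubmonoidClass.coe_finsetSum, Finset.sum_apply]
    refine Eq.trans ?_ (hs 1 g⁻¹)
    rw [one_mul]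
    rfl
  have h3 : f = ∑ i ∈ s, i.2.1 1 • i.1 := by
    refine CoordRing.ext fun g => ?_
    rw [AddSubmonoidClass.coe_finsetSum, Finset.sum_apply]
    refine (congrArg f.1 (mul_one g).symm).trans ((hs g 1).trans ?_)
    exact Finset.sum_congr rfl fun i _ => mul_comm _ _
  have h4 := congrArg v.1 h1
  rw [tangent_map_algebraMap v, map_sum] at h4
  rw [eq_neg_iff_add_eq_zero, h2]
  nth_rewrite 1 [h3]
  rw [map_sum, map_sum, ← Finset.sum_add_distrib, ← h4]
  refine Finset.sum_congr rfl fun i _ => ?_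
  rw [tangent_map_mul v, map_smul, map_smul]
  have h5 : ((invMor G).pullback i.2).1 1 = i.2.1 1 := by
    change i.2.1 (1 : G)⁻¹ = _
    rw [inv_one]
  rw [h5]
  rfl

/-- The derivative of `g ↦ Ad_g(D)` at the identity. -/
lemma toTangent_of_eq_Ad (y D : LieAlg G) (f R : CoordRing G)
    (hR : ∀ g, R.1 g = ((Ad g D).1 f).1 1) : y.toTangent.1 R = (⁅y, D⁆.1 f).1 1 := by
  obtain ⟨s, hs⟩ := exists_comultiplication f
  -- With `f (g * h) = ∑ aᵢ(g) bᵢ(h)` one gets `R = ∑ (bᵢ ∘ inv) · D aᵢ`. The Leibniz rule for `y`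
  -- at the identity gives two sums, which are `y (D f)` and `-D (y f)`.
  have h1 : R = ∑ i ∈ s, (invMor G).pullback i.2 * D.1 i.1 := by
    refine CoordRing.ext fun g => ?_
    have h2 : (rightMul g⁻¹).pullback f = ∑ i ∈ s, i.2.1 g⁻¹ • i.1 := by
      refine CoordRing.ext fun h => ?_
      rw [AddSubmonoidClass.coe_finsetSum, Finset.sum_apply]
      exact (hs h g⁻¹).trans (Finset.sum_congr rfl fun i _ => mul_comm _ _)
    rw [hR, AddSubmonoidClass.coe_finsetSum, Finset.sum_apply]
    change (D.1 ((rightMul g⁻¹).pullback f)).1 (1 * g) = _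
    rw [h2, one_mul, map_sum, AddSubmonoidClass.coe_finsetSum, Finset.sum_apply]
    refine Finset.sum_congr rfl fun i _ => ?_
    rw [Derivation.map_smul]
    rfl
  have h3 : f = ∑ i ∈ s, i.2.1 1 • i.1 := by
    refine CoordRing.ext fun g => ?_
    rw [AddSubmonoidClass.coe_finsetSum, Finset.sum_apply]
    refine (congrArg f.1 (mul_one g).symm).trans ((hs g 1).trans ?_)
    exact Finset.sum_congr rfl fun i _ => mul_comm _ _
  have h4 : y.1 f = ∑ i ∈ s, y.toTangent.1 i.2 • i.1 := by
    refine CoordRing.ext fun g => ?_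
    have h5 : (leftMul g).pullback f = ∑ i ∈ s, i.1.1 g • i.2 := by
      refine CoordRing.ext fun h => ?_
      rw [AddSubmonoidClass.coe_finsetSum, Finset.sum_apply]
      exact hs g h
    rw [LieAlg.apply_apply, h5, map_sum, AddSubmonoidClass.coe_finsetSum, Finset.sum_apply]
    refine Finset.sum_congr rfl fun i _ => ?_
    rw [map_smul]
    exact mul_comm _ _
  have h6 : (⁅y, D⁆.1 f).1 1 = y.toTangent.1 (D.1 f) - D.toTangent.1 (y.1 f) := by
    rw [LieSubalgebra.coe_bracket, Derivation.commutator_apply]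
    rfl
  rw [h6, h4]
  nth_rewrite 1 [h3]
  rw [h1]
  simp only [map_sum, Derivation.map_smul, map_smul]
  rw [← Finset.sum_sub_distrib]
  refine Finset.sum_congr rfl fun i _ => ?_
  rw [tangent_map_mul, tangent_pullback_invMor]
  have h7 : ((invMor G).pullback i.2).1 1 = i.2.1 1 := by
    change i.2.1 (1 : G)⁻¹ = _
    rw [inv_one]
  rw [h7, smul_eq_mul, smul_eq_mul]
  change _ + D.toTangent.1 i.1 * _ = _
  ring

/-- The linear functional `D ↦ (D f)(e)` on `𝔤`. -/
def evalFunctional (f : CoordRing G) : Module.Dual ℂ (LieAlg G) where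
  toFun D := D.toTangent.1 f
  map_add' _ _ := rfl
  map_smul' _ _ := rfl

/-- An element of `𝔤` is determined by its tangent vector at the identity, so these functionals have
no common zero but `0`. Identities linear in a functional need only be checked on them. -/
lemma span_evalFunctional :
    Submodule.span ℂ (Set.range (evalFunctional : CoordRing G → Module.Dual ℂ (LieAlg G))) = ⊤ := by
  rw [← Subspace.dualCoannihilator_dualAnnihilator_eq (K := ℂ) (V := LieAlg G)
    (W := Submodule.span ℂ (Set.range (evalFunctional : CoordRing G → Module.Dual ℂ (LieAlg G))))]
  have : (Submodule.span ℂ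
      (Set.range (evalFunctional : CoordRing G → Module.Dual ℂ (LieAlg G)))).dualCoannihilator = ⊥ := by
    rw [eq_bot_iff]
    intro D hD
    rw [Submodule.mem_dualCoannihilator] at hD
    refine (Submodule.mem_bot ℂ).2 (LieAlg.toTangent_injective ?_)
    refine Subtype.ext (LinearMap.ext fun f => ?_)
    exact hD _ (Submodule.subset_span ⟨f, rfl⟩)
  rw [this]
  exact Submodule.dualAnnihilator_bot

lemma Ad_mul (g h : G) (D : LieAlg G) : Ad g (Ad h D) = Ad (g * h) D := by
  refine Subtype.ext (Derivation.ext fun f => CoordRing.ext fun k => ?_)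
  change (D.1 ((rightMul h⁻¹).pullback ((rightMul g⁻¹).pullback f))).1 (k * g * h) =
    (D.1 ((rightMul (g * h)⁻¹).pullback f)).1 (k * (g * h))
  have e : (rightMul h⁻¹).pullback ((rightMul g⁻¹).pullback f) = (rightMul (g * h)⁻¹).pullback f := by
    refine CoordRing.ext fun x => ?_
    change f.1 (x * h⁻¹ * g⁻¹) = f.1 (x * (g * h)⁻¹)
    rw [mul_inv_rev, mul_assoc]
  rw [mul_assoc, e]

end GroupLie

/-! ### Fundamental vector fields and the differential of an action. -/

section Actions

variable {G : Type u} [Group G] [HasRegularFunctions G] [IsAlgebraicGroup G]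
  {X : Type v} [HasRegularFunctions X] [MulAction G X] [IsAlgebraicAction G X]

/-- The fundamental vector field of `z ∈ 𝔤` as a derivation of `ℂ[X]`. -/
def fundamentalDerivation (z : LieAlg G) : Derivation ℂ (CoordRing X) (CoordRing X) :=
  Derivation.mk'
    { toFun := fun f => ⟨fun x => fundamental z x f,
        apply_slice_mem ((actMor G X).comp ((snd X G).prodMk (fst X G))) z.toTangent.1 f⟩
      map_add' := fun f g => CoordRing.ext fun x => map_add (fundamental z x) f g
      map_smul' := fun c f => CoordRing.ext fun x => map_smul (fundamental z x) c f }
    (fun f g => CoordRing.ext fun x => fundamental_mem z x f g)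

/-- The derivative of an equivariant map to `𝔤` along a fundamental vector field. -/
lemma fundamental_pullback_linearFun {μ : Morphism X (LieAlg G)}
    (hμ : ∀ (g : G) (x : X), μ (g • x) = Ad g (μ x)) (y : LieAlg G) (x : X)
    (l : Module.Dual ℂ (LieAlg G)) :
    fundamental y x (μ.pullback (linearFun l)) = l ⁅y, μ x⁆ := by
  have hl : l ∈ Submodule.span ℂ
      (Set.range (evalFunctional : CoordRing G → Module.Dual ℂ (LieAlg G))) := by
    rw [span_evalFunctional]; trivial
  induction hl using Submodule.span_induction with
  | mem l hl =>
    obtain ⟨f, rfl⟩ := hl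
    refine toTangent_of_eq_Ad y (μ x) f _ fun g => ?_
    rw [← hμ]
    rfl
  | zero =>
    have : linearFun (0 : Module.Dual ℂ (LieAlg G)) = 0 := rfl
    rw [this, map_zero, map_zero]; rfl
  | add l l' _ _ h h' =>
    have : linearFun (l + l') = linearFun l + linearFun l' := rfl
    rw [this, map_add, map_add, h, h']; rfl
  | smul c l _ h =>
    have : linearFun (c • l) = c • linearFun l := rfl
    rw [this, map_smul, map_smul, h]; rfl

lemma toTangent_rightTriv (g : G) (a : Tangent g) (x : X) (f : CoordRing X) :
    a.1 ((orbitMor G x).pullback f) = fundamental (rightTriv g a) (g • x) f := by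
  change _ = a.1 _
  congr 1
  refine CoordRing.ext fun k => ?_
  change f.1 (k • x) = f.1 ((1 * k * g⁻¹) • g • x)
  rw [one_mul, mul_smul, inv_smul_smul]

/-- The differential of the action map. -/
lemma differential_actMor (p : G × X) (u : Tangent p) (f : CoordRing X) :
    ((actMor G X).differential p u).1 f =
      fundamental (rightTriv p.1 (tangentFst u)) (p.1 • p.2) f +
        ((actBy p.1).differential p.2 (tangentSnd u)).1 f := by
  rw [← toTangent_rightTriv]
  exact tangent_prod_apply u ((actMor G X).pullback f)

end Actions

/-! ### Closed subvarieties and their smoothness. -/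

section ClosedSubvarieties

variable {X : Type u} [HasRegularFunctions X]

lemma pullback_incl_surjective (Z : Set X) : Function.Surjective (incl Z).pullback := by
  rintro ⟨_, f, hf, rfl⟩
  exact ⟨⟨f, hf⟩, rfl⟩

lemma differential_incl_injective {Z : Set X} (p : Z) :
    Function.Injective ((incl Z).differential p) := by
  intro v w h
  refine Subtype.ext (LinearMap.ext fun f => ?_)
  obtain ⟨f, rfl⟩ := pullback_incl_surjective Z f
  exact congrArg (fun v : Tangent ((incl Z) p) => v.1 f) h

/-- The tangent vectors of a subvariety are the ambient ones that annihilate its ideal. -/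
lemma exists_differential_incl_eq {Z : Set X} (p : Z) (v : Tangent p.1)
    (hv : ∀ f : CoordRing X, (∀ x ∈ Z, f.1 x = 0) → v.1 f = 0) :
    ∃ w : Tangent p, (incl Z).differential p w = v := by
  choose s hs using pullback_incl_surjective Z
  have key : ∀ f f' : CoordRing X, (incl Z).pullback f = (incl Z).pullback f' → v.1 f = v.1 f' := by
    intro f f' h
    rw [← sub_eq_zero, ← map_sub]
    refine hv _ fun x hx => ?_
    exact sub_eq_zero.2 (congrFun (congrArg Subtype.val h) ⟨x, hx⟩)
  have heval : ∀ f, (s f).1 p.1 = f.1 p := fun f =>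
    congrFun (congrArg Subtype.val (hs f)) p
  refine ⟨⟨{ toFun := fun f => v.1 (s f), map_add' := ?_, map_smul' := ?_ }, ?_⟩, ?_⟩
  · intro f g
    rw [← map_add]
    exact key _ _ (by rw [hs, map_add, hs, hs])
  · intro c f
    rw [RingHom.id_apply, ← map_smul]
    exact key _ _ (by rw [hs, map_smul, hs])
  · intro f g
    change v.1 (s (f * g)) = f.1 p * v.1 (s g) + g.1 p * v.1 (s f)
    rw [← heval, ← heval, ← tangent_map_mul]
    exact key _ _ (by rw [hs, map_mul, hs, hs])
  · refine Subtype.ext (LinearMap.ext fun f => ?_)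
    exact key _ _ (hs _)

lemma isAffineVariety_of_isZariskiClosed [IsAffineVariety X] {Z : Set X} (hZ : IsZariskiClosed Z) :
    IsAffineVariety Z := by
  obtain ⟨I, rfl⟩ := hZ
  refine ⟨?_, ?_, ?_⟩
  · have := IsAffineVariety.finiteType (X := X)
    exact Algebra.FiniteType.of_surjective (incl _).pullback (pullback_incl_surjective _)
  · intro p q h
    refine Subtype.ext (IsAffineVariety.evalAt_bijective.1 (AlgHom.ext fun f => ?_))
    exact congrArg (fun χ : _ →ₐ[ℂ] ℂ => χ ((incl _).pullback f)) h
  · intro χ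
    obtain ⟨x, hx⟩ := IsAffineVariety.evalAt_bijective.2 (χ.comp (incl _).pullback)
    refine ⟨⟨x, fun f hf => ?_⟩, AlgHom.ext fun f => ?_⟩
    · have h1 : f.1 x = χ ((incl {x : X | ∀ f ∈ I, f.1 x = 0}).pullback f) :=
        congrArg (fun χ : _ →ₐ[ℂ] ℂ => χ f) hx
      have h2 : (incl {x : X | ∀ f ∈ I, f.1 x = 0}).pullback f = 0 :=
        CoordRing.ext fun y => y.2 f hf
      rw [h1, h2, map_zero]
    · obtain ⟨f, rfl⟩ := pullback_incl_surjective _ f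
      exact congrArg (fun χ : _ →ₐ[ℂ] ℂ => χ f) hx

/-- The Jacobian criterion for a closed subvariety. -/
lemma smooth_of_det_ne_zero [IsAffineVariety X] [Algebra.Smooth ℂ (CoordRing X)] {n : ℕ}
    (f : Fin n → CoordRing X) (D : Fin n → Derivation ℂ (CoordRing X) (CoordRing X)) (Z : Set X)
    (hZ : Z = {x | ∀ i, (f i).1 x = 0})
    (hD : ∀ x ∈ Z, (Matrix.of fun i j => (D j (f i)).1 x).det ≠ 0) :
    Algebra.Smooth ℂ (CoordRing Z) ∧
      ∀ g : CoordRing X, (∀ x ∈ Z, g.1 x = 0) → g ∈ Ideal.span (Set.range f) := by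
  have hft : Algebra.FiniteType ℂ (CoordRing X) := IsAffineVariety.finiteType
  set J := Ideal.span (Set.range f) with hJ
  have hfJ : ∀ i, f i ∈ J := fun i => Ideal.subset_span ⟨i, rfl⟩
  have hpt : ∀ χ : (CoordRing X ⧸ J) →ₐ[ℂ] ℂ, ∃ x ∈ Z, ∀ g, χ (Ideal.Quotient.mk J g) = g.1 x := by
    intro χ
    obtain ⟨x, hx⟩ := IsAffineVariety.evalAt_bijective.2 (χ.comp (Ideal.Quotient.mkₐ ℂ J))
    have hx' : ∀ g, χ (Ideal.Quotient.mk J g) = g.1 x := fun g =>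
      (congrArg (fun χ : _ →ₐ[ℂ] ℂ => χ g) hx).symm
    refine ⟨x, ?_, hx'⟩
    rw [hZ]
    intro i
    rw [← hx', Ideal.Quotient.eq_zero_iff_mem.2 (hfJ i), map_zero]
  let M : Matrix (Fin n) (Fin n) (CoordRing X) := Matrix.of fun i j => D j (f i)
  -- By the Nullstellensatz, a nonunit of `ℂ[X] / J` vanishes at some point of `Z`.
  have hM : IsUnit (Ideal.Quotient.mk J M.det) := by
    by_contra hu
    obtain ⟨m, hm, hmem⟩ := exists_max_ideal_of_mem_nonunits (α := CoordRing X ⧸ J) hu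
    obtain ⟨χ, hχ⟩ := exists_algHom_ker_eq (B := CoordRing X ⧸ J) m
    obtain ⟨x, hx, hxe⟩ := hpt χ
    rw [← hχ, RingHom.mem_ker, hxe] at hmem
    refine hD x hx ?_
    have h1 := RingHom.map_det (evalAt x).toRingHom M
    exact h1.symm.trans hmem
  obtain ⟨d, hd⟩ := Ideal.Quotient.mk_surjective (hM.unit⁻¹.1)
  have hdJ : d * M.det - 1 ∈ J := by
    rw [← Ideal.Quotient.eq_zero_iff_mem, map_sub, map_mul, hd, map_one, sub_eq_zero]
    exact hM.val_inv_mul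
  have hsm : Algebra.FormallySmooth ℂ (CoordRing X ⧸ J) := by
    -- The adjugate times the inverse `d` of the determinant turns the `D j` into derivations dual
    -- to the `f i` modulo `J`.
    refine formallySmooth_quotient f (fun k => ∑ j, (d * M.adjugate j k) • D j) J hJ ?_
    intro k i
    have h1 : (∑ j, (d * M.adjugate j k) • D j) (f i) = d * (M * M.adjugate) i k := by
      change Derivation.coeFnAddMonoidHom (∑ j, (d * M.adjugate j k) • D j) (f i) = _
      rw [map_sum, Finset.sum_apply, Matrix.mul_apply, Finset.mul_sum]
      refine Finset.sum_congr rfl fun j _ => ?_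
      change d * M.adjugate j k * D j (f i) = d * (D j (f i) * _)
      ring
    rw [h1, Matrix.mul_adjugate, Matrix.smul_apply, Matrix.one_apply, smul_eq_mul]
    by_cases hik : i = k
    · rw [if_pos hik, if_pos hik.symm, mul_one]; exact hdJ
    · rw [if_neg hik, if_neg (Ne.symm hik)]; simp
  have hft' : Algebra.FiniteType ℂ (CoordRing X ⧸ J) := inferInstance
  have hred := isReduced_of_formallySmooth (B := CoordRing X ⧸ J)
  -- Since `ℂ[X] / J` is reduced, `J` is the full vanishing ideal of `Z`; so `ℂ[Z]`, defined by
  -- restriction of functions, is this smooth quotient.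
  have hvan : ∀ g : CoordRing X, (∀ x ∈ Z, g.1 x = 0) → g ∈ J := by
    intro g hg
    rw [← Ideal.Quotient.eq_zero_iff_mem]
    refine eq_zero_of_forall_algHom (B := CoordRing X ⧸ J) fun χ => ?_
    obtain ⟨x, hx, hxe⟩ := hpt χ
    rw [hxe, hg x hx]
  refine ⟨?_, hvan⟩
  have hker : RingHom.ker (incl Z).pullback = J := by
    ext g
    rw [RingHom.mem_ker]
    constructor
    · intro h
      exact hvan g fun x hx => congrFun (congrArg Subtype.val h) ⟨x, hx⟩
    · intro h
      obtain ⟨c, rfl⟩ := Ideal.mem_span_range_iff_exists_fun.1 h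
      rw [map_sum]
      refine Finset.sum_eq_zero fun i _ => CoordRing.ext fun z => ?_
      have hz : z.1 ∈ {x | ∀ i, (f i).1 x = 0} := hZ ▸ z.2
      change (c i).1 z.1 * (f i).1 z.1 = 0
      rw [hz i, mul_zero]
  have hsm' : Algebra.Smooth ℂ (CoordRing X ⧸ J) :=
    { formallySmooth := hsm
      finitePresentation := (Algebra.FinitePresentation.of_finiteType (R := ℂ)
        (A := CoordRing X ⧸ J)).1 hft' }
  rw [← hker] at hsm'
  exact Algebra.Smooth.of_equiv (A := CoordRing X ⧸ RingHom.ker (incl Z).pullback)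
    (Ideal.quotientKerAlgEquivOfSurjective (pullback_incl_surjective Z))

end ClosedSubvarieties

/-! ### Pullbacks of symplectic forms. -/

section PullbackForms

variable {X : Type u} {Y : Type v} [HasRegularFunctions X] [HasRegularFunctions Y]

/-- Tangent spaces at equal points are different types; comparing the underlying functionals on
`ℂ[X]` avoids casts. -/
lemma TwoForm.congr_point (ω : TwoForm X) {p q : X} (h : p = q) {v w : Tangent p} {v' w' : Tangent q}
    (hv : v.1 = v'.1) (hw : w.1 = w'.1) : ω p v w = ω q v' w' := by
  subst h
  rw [Subtype.ext hv, Subtype.ext hw]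

lemma IsSymplecticForm.antisymm {ω : TwoForm X} (hω : IsSymplecticForm ω) (p : X)
    (v w : Tangent p) : ω p v w = -ω p w v := by
  obtain ⟨n, a, b, c, h, -⟩ := hω.algebraic_closed
  rw [h, h, evalTwoForm, evalTwoForm, ← Finset.sum_neg_distrib]
  exact Finset.sum_congr rfl fun i _ => by ring

lemma IsSymplecticForm.pullback {ω : TwoForm Y} (hω : IsSymplecticForm ω) (φ : Morphism X Y)
    (h : ∀ p (v : Tangent p), (∀ w, TwoForm.pullback φ ω p v w = 0) → v = 0) :
    IsSymplecticForm (TwoForm.pullback φ ω) := by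
  obtain ⟨n, a, b, c, h1, h2⟩ := hω.algebraic_closed
  refine ⟨⟨n, fun i => φ.pullback (a i), fun i => φ.pullback (b i), fun i => φ.pullback (c i),
    fun p v w => ?_, fun p v₁ v₂ v₃ => ?_⟩, h⟩
  · exact h1 (φ p) _ _
  · exact h2 (φ p) (φ.differential p v₁) (φ.differential p v₂) (φ.differential p v₃)

end PullbackForms

/-! ### Slodowy slices and the Killing form. -/

section KillingSlice

variable {L : Type*} [LieRing L] [LieAlgebra ℂ L]

lemma killingForm_lie_left (x y z : L) :
    killingForm ℂ L ⁅x, y⁆ z = -killingForm ℂ L y ⁅x, z⁆ := by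
  rw [← lie_skew, map_neg, LinearMap.neg_apply]
  exact congrArg Neg.neg (LieModule.traceForm_apply_lie_apply ℂ L L y x z)

variable [FiniteDimensional ℂ L] [LieAlgebra.HasTrivialRadical ℂ L]

lemma eq_zero_of_killingForm_eq_zero {w : L} (h : ∀ z, killingForm ℂ L z w = 0) : w = 0 := by
  have h1 := LieAlgebra.IsKilling.ker_killingForm_eq_bot ℂ L
  rw [LinearMap.ker_eq_bot'] at h1
  refine h1 w (LinearMap.ext fun z => ?_)
  rw [LieModule.traceForm_comm]
  exact h z

/-- By invariance and nondegeneracy of the Killing form, `ker (ad η)` is the orthogonal complement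
of `im (ad η)`. -/
lemma lie_eq_zero_iff_killingForm (η w : L) :
    ⁅η, w⁆ = 0 ↔ ∀ a, killingForm ℂ L ⁅η, a⁆ w = 0 := by
  constructor
  · intro h a
    rw [killingForm_lie_left, h, map_zero, neg_zero]
  · intro h
    refine eq_zero_of_killingForm_eq_zero fun a => ?_
    have := h a
    rwa [killingForm_lie_left, neg_eq_zero] at this

/-- Linear equations of a Slodowy slice, with a nondegenerate matrix of Lie brackets. -/
lemma exists_slice_equations {ξ h η : L} (t : IsTriple ξ h η) :
    ∃ (n : ℕ) (z : Fin n → L),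
      (∀ s, s ∈ slodowySlice ξ η ↔ ∀ i, killingForm ℂ L (z i) s - killingForm ℂ L (z i) ξ = 0) ∧
      ∀ s ∈ slodowySlice ξ η,
        (Matrix.of fun i j => killingForm ℂ L (z i) ⁅z j, s⁆).det ≠ 0 := by
  let W := LinearMap.range (LieAlgebra.ad ℂ L η)
  let b := Module.finBasis ℂ W
  have hb : ∀ w : L, (∀ i, killingForm ℂ L (b i).1 w = 0) → ⁅η, w⁆ = 0 := by
    intro w hw
    rw [lie_eq_zero_iff_killingForm]
    intro a
    have h1 : (⁅η, a⁆ : L) = (∑ i, b.repr ⟨⁅η, a⁆, a, rfl⟩ i • b i : W) := by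
      rw [b.sum_repr]
    rw [h1, AddSubmonoidClass.coe_finsetSum, map_sum, LinearMap.sum_apply]
    refine Finset.sum_eq_zero fun i _ => ?_
    rw [Submodule.coe_smul, map_smul, LinearMap.smul_apply, hw, smul_zero]
  refine ⟨_, fun i => (b i).1, fun s => ⟨?_, ?_⟩, fun s hs hdet => ?_⟩
  · rintro ⟨k, hk, rfl⟩ i
    obtain ⟨a, ha⟩ := (b i).2
    have ha' : (b i).1 = ⁅η, a⁆ := ha.symm
    change killingForm ℂ L (b i).1 (ξ + k) - killingForm ℂ L (b i).1 ξ = 0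
    rw [map_add, add_sub_cancel_left, ha', (lie_eq_zero_iff_killingForm η k).1 hk]
  · intro hs
    refine ⟨s - ξ, hb _ fun i => ?_, by abel⟩
    rw [map_sub]
    exact hs i
  · obtain ⟨v, hv0, hv⟩ := Matrix.exists_mulVec_eq_zero_iff.2 hdet
    obtain ⟨a, ha⟩ := (∑ j, v j • b j : W).2
    have ha' : ⁅η, a⁆ = (∑ j, v j • b j : W) := ha
    have h1 : ⁅η, ⁅⁅η, a⁆, s⁆⁆ = 0 := by
      refine hb _ fun i => ?_
      have h2 := congrFun hv i
      rw [Matrix.mulVec, dotProduct, Pi.zero_apply] at h2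
      rw [ha', AddSubmonoidClass.coe_finsetSum, sum_lie, map_sum, ← h2]
      refine Finset.sum_congr rfl fun j _ => ?_
      rw [Submodule.coe_smul, smul_lie, map_smul, smul_eq_mul, mul_comm]
      rfl
    have h3 := t.eq_zero_of_lie_slice hs h1
    rw [ha'] at h3
    have h4 := Fintype.linearIndependent_iff.1 b.linearIndependent v (Subtype.ext h3)
    exact hv0 (funext h4)

end KillingSlice

/-! ### The preimage of the slice is a symplectic subvariety. -/

section SlicePreimage

variable {G : Type u} [Group G] [HasRegularFunctions G] [IsAlgebraicGroup G]
  {X : Type v} [HasRegularFunctions X] [MulAction G X] [IsAlgebraicAction G X]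

lemma fundamental_pullback_killingFun {ω : TwoForm X} {μ : Morphism X (LieAlg G)}
    (hμ : IsHamiltonian ω μ) (y z : LieAlg G) (x : X) :
    fundamental y x (μ.pullback (killingFun z)) = killingForm ℂ (LieAlg G) z ⁅y, μ x⁆ :=
  fundamental_pullback_linearFun hμ.equivariant y x _

variable [LieAlgebra.HasTrivialRadical ℂ (LieAlg G)]

theorem isSymplecticSubvariety_slicePreimage {ω : TwoForm X} (hω : IsSymplecticVariety X ω)
    {μ : Morphism X (LieAlg G)} (hμ : IsHamiltonian ω μ) {ξ h η : LieAlg G}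
    (t : IsTriple ξ h η) :
    IsSymplecticSubvariety (slicePreimage μ (slodowySlice ξ η)) ω := by
  have := hω.affine
  have := hω.smooth
  obtain ⟨n, z, hz, hdet⟩ := exists_slice_equations t
  let κ := killingForm ℂ (LieAlg G)
  let f : Fin n → CoordRing X := fun i =>
    μ.pullback (killingFun (z i)) - algebraMap ℂ _ (κ (z i) ξ)
  have hf : ∀ i x, (f i).1 x = κ (z i) (μ x) - κ (z i) ξ := fun i x => rfl
  set Z := slicePreimage μ (slodowySlice ξ η) with hZdef
  have hZ : Z = {x | ∀ i, (f i).1 x = 0} := by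
    ext x
    exact hz (μ x)
  have hclosed : IsZariskiClosed Z := by
    refine ⟨Set.range f, ?_⟩
    rw [hZ]
    ext x
    simp
  have htan : ∀ (y : LieAlg G) x i, fundamental y x (f i) = κ (z i) ⁅y, μ x⁆ := by
    intro y x i
    have h1 := tangent_map_algebraMap ⟨fundamental y x, fundamental_mem y x⟩ (κ (z i) ξ)
    change fundamental y x (_ - _) = _
    rw [map_sub, h1, sub_zero]
    exact fundamental_pullback_killingFun hμ y (z i) x
  have hmat : ∀ x, (Matrix.of fun i j => (fundamentalDerivation (z j) (f i)).1 x) =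
      Matrix.of fun i j => κ (z i) ⁅z j, μ x⁆ := by
    intro x
    ext i j
    exact htan (z j) x i
  obtain ⟨hsm, hvan⟩ := smooth_of_det_ne_zero f (fun j => fundamentalDerivation (z j)) Z hZ (by
    intro x hx
    rw [hmat]
    exact hdet _ hx)
  refine ⟨hclosed, isAffineVariety_of_isZariskiClosed hclosed, hsm,
    hω.symplectic.pullback _ fun p v hv => ?_⟩
  let v' : Tangent p.1 := (incl Z).differential p v
  have hp : ∀ i, (f i).1 p.1 = 0 := by
    have : p.1 ∈ {x | ∀ i, (f i).1 x = 0} := hZ ▸ p.2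
    exact this
  let F : LieAlg G → Tangent p.1 := fun y => ⟨fundamental y p.1, fundamental_mem y p.1⟩
  have hF : ∀ i (u : Tangent p.1), ω p.1 (F (z i)) u = u.1 (f i) := by
    intro i u
    rw [← hμ.moment (z i) p.1 u]
    change _ = u.1 (_ - _)
    rw [map_sub, tangent_map_algebraMap, sub_zero]
  -- By the moment map identity `ω (F (z i)) = df_i`, and the common kernel of the `df_i` is the
  -- tangent space of `Z`, the `f i` generating its ideal. A functional that vanishes there is a
  -- combination of the `df_i`.
  have hspan : ω p.1 v' ∈ Submodule.span ℂ (Set.range fun i => ω p.1 (F (z i))) := by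
    refine mem_span_of_iInf_ker_le_ker fun u hu => ?_
    rw [Submodule.mem_iInf] at hu
    obtain ⟨w, hw⟩ := exists_differential_incl_eq p u fun g hg => by
      obtain ⟨c, rfl⟩ := Ideal.mem_span_range_iff_exists_fun.1 (hvan g hg)
      rw [map_sum]
      refine Finset.sum_eq_zero fun i _ => ?_
      have h1 : u.1 (f i) = 0 := (hF i u).symm.trans (hu i)
      rw [tangent_map_mul, h1, hp, mul_zero, zero_mul, add_zero]
    rw [LinearMap.mem_ker, ← hw]
    exact hv w
  obtain ⟨c, hc⟩ := (Submodule.mem_span_range_iff_exists_fun ℂ).1 hspan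
  have hv' : v' = ∑ i, c i • F (z i) := by
    rw [← sub_eq_zero]
    refine hω.symplectic.nondegenerate p.1 _ fun w => ?_
    rw [map_sub, map_sum, ← hc, LinearMap.sub_apply]
    simp
  have hv0 : ∀ i, v'.1 (f i) = 0 := by
    intro i
    change v.1 ((incl Z).pullback (f i)) = 0
    have : (incl Z).pullback (f i) = 0 := CoordRing.ext fun y => by
      have : y.1 ∈ {x | ∀ i, (f i).1 x = 0} := hZ ▸ y.2
      exact this i
    rw [this, map_zero]
  -- So `v'` is a combination of the fundamental vectors `F (z j)`. It is also tangent to `Z`, hence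
  -- killed by all `df_i`, and its coefficients form a kernel vector of the invertible matrix `df_i
  -- (F (z j))`.
  have hc0 : c = 0 := by
    by_contra hne
    refine hdet (μ p.1) p.2 (Matrix.exists_mulVec_eq_zero_iff.1 ⟨c, hne, funext fun i => ?_⟩)
    have h1 := hv0 i
    rw [hv', AddSubmonoidClass.coe_finsetSum, LinearMap.sum_apply] at h1
    rw [Pi.zero_apply, ← h1, Matrix.mulVec, dotProduct]
    refine Finset.sum_congr rfl fun j _ => ?_
    rw [Submodule.coe_smul, LinearMap.smul_apply]
    change _ = c j * fundamental (z j) p.1 (f i)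
    rw [htan, mul_comm]
    rfl
  have hv'0 : v' = 0 := by simp [hv', hc0]
  exact differential_incl_injective p (hv'0.trans (map_zero ((incl Z).differential p)).symm)

end SlicePreimage

/-! ### Transport of structure along isomorphisms. -/

section Isomorphisms

variable {X : Type u} {Y : Type v} [HasRegularFunctions X] [HasRegularFunctions Y]
  {φ : Morphism X Y} {ψ : Morphism Y X}

/-- The isomorphism of coordinate rings induced by an isomorphism of varieties. -/
def coordRingEquiv (h₁ : ∀ x, ψ (φ x) = x) (h₂ : ∀ y, φ (ψ y) = y) :
    CoordRing X ≃ₐ[ℂ] CoordRing Y :=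
  AlgEquiv.ofAlgHom ψ.pullback φ.pullback
    (AlgHom.ext fun f => CoordRing.ext fun y => congrArg f.1 (h₂ y))
    (AlgHom.ext fun f => CoordRing.ext fun x => congrArg f.1 (h₁ x))

lemma isAffineVariety_of_iso [IsAffineVariety X] (h₁ : ∀ x, ψ (φ x) = x)
    (h₂ : ∀ y, φ (ψ y) = y) : IsAffineVariety Y := by
  refine ⟨(IsAffineVariety.finiteType (X := X)).equiv (coordRingEquiv h₁ h₂), ?_, ?_⟩
  · intro p q h
    rw [← h₂ p, ← h₂ q]
    refine congrArg φ.toFun (IsAffineVariety.evalAt_bijective.1 (AlgHom.ext fun f => ?_))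
    exact congrArg (fun χ : _ →ₐ[ℂ] ℂ => χ (ψ.pullback f)) h
  · intro χ
    obtain ⟨x, hx⟩ := IsAffineVariety.evalAt_bijective.2 (χ.comp ψ.pullback)
    refine ⟨φ x, AlgHom.ext fun f => ?_⟩
    have h3 := congrArg (fun χ : _ →ₐ[ℂ] ℂ => χ (φ.pullback f)) hx
    refine h3.trans (congrArg χ ?_)
    exact CoordRing.ext fun y => congrArg f.1 (h₂ y)

lemma exists_differential_eq_of_iso (h₁ : ∀ x, ψ (φ x) = x) (h₂ : ∀ y, φ (ψ y) = y) (y : Y)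
    (w : Tangent (ψ y)) : ∃ v : Tangent y, ψ.differential y v = w := by
  refine ⟨⟨w.1.comp φ.pullback.toLinearMap, fun f g => ?_⟩, ?_⟩
  · have h := ((φ.differential (ψ y)) w).2 f g
    change _ = f.1 (φ (ψ y)) * _ + g.1 (φ (ψ y)) * _ at h
    have hf : f.1 (φ (ψ y)) = f.1 y := congrArg f.1 (h₂ y)
    have hg : g.1 (φ (ψ y)) = g.1 y := congrArg g.1 (h₂ y)
    rw [hf, hg] at h
    exact h
  · refine Subtype.ext (LinearMap.ext fun f => congrArg w.1 ?_)
    exact CoordRing.ext fun x => congrArg f.1 (h₁ x)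

lemma differential_injective_of_leftInverse (h₂ : ∀ y, φ (ψ y) = y) (y : Y) :
    Function.Injective (ψ.differential y) := by
  intro v w h
  refine Subtype.ext (LinearMap.ext fun f => ?_)
  have h3 := congrArg (fun v : Tangent (ψ y) => v.1 (φ.pullback f)) h
  have h4 : ψ.pullback (φ.pullback f) = f := CoordRing.ext fun y => congrArg f.1 (h₂ y)
  have h5 : v.1 (ψ.pullback (φ.pullback f)) = w.1 (ψ.pullback (φ.pullback f)) := h3
  rwa [h4] at h5

lemma IsSymplecticVariety.of_iso {ω : TwoForm X} (hω : IsSymplecticVariety X ω)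
    (h₁ : ∀ x, ψ (φ x) = x) (h₂ : ∀ y, φ (ψ y) = y) :
    IsSymplecticVariety Y (TwoForm.pullback ψ ω) := by
  have := hω.affine
  have := hω.smooth
  refine ⟨isAffineVariety_of_iso h₁ h₂, Algebra.Smooth.of_equiv (coordRingEquiv h₁ h₂),
    hω.symplectic.pullback ψ fun p v hv => ?_⟩
  refine differential_injective_of_leftInverse h₂ p ?_
  rw [map_zero]
  refine hω.symplectic.nondegenerate _ _ fun w => ?_
  obtain ⟨w, rfl⟩ := exists_differential_eq_of_iso h₁ h₂ p w
  exact hv w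

end Isomorphisms

/-! ### The preimage of the slice as the quotient of the zero fibre. -/

section SliceQuotient

lemma quotientMap_eq_of_smul {G : Type u} [Group G] {M : Type v} [HasRegularFunctions M]
    [MulAction G M] {V : Type w} [Zero V] {ν : M → V} {p q : zeroFiber ν} {g : G} (h : q.1 = g • p.1) :
    quotientMap G ν p = quotientMap G ν q :=
  SymplecticQuotient.ext (AlgHom.ext fun f => (f.2 g p q h).symm)

variable {G : Type u} [Group G] [HasRegularFunctions G] [IsAlgebraicGroup G]
  {X : Type v} [HasRegularFunctions X] [MulAction G X] [IsAlgebraicAction G X]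

/-- The projection of `X × (G × S)` to `G`. -/
def groupCoord (X : Type v) [HasRegularFunctions X] (S : Set (LieAlg G)) :
    Morphism (X × GroupProd S) G :=
  (fst G (LieAlg G)).comp ((groupProdIncl S).comp (snd X (GroupProd S)))

/-- The projection of `X × (G × S)` to `𝔤`. -/
def sliceCoord (X : Type v) [HasRegularFunctions X] (S : Set (LieAlg G)) :
    Morphism (X × GroupProd S) (LieAlg G) :=
  (snd G (LieAlg G)).comp ((groupProdIncl S).comp (snd X (GroupProd S)))

/-- The morphism `(x, (g, y)) ↦ g • x`. -/
def totalAct (X : Type v) [HasRegularFunctions X] [MulAction G X] [IsAlgebraicAction G X]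
    (S : Set (LieAlg G)) : Morphism (X × GroupProd S) X :=
  (actMor G X).comp ((groupCoord X S).prodMk (fst X (GroupProd S)))

lemma moment_totalAct {μ : Morphism X (LieAlg G)} (hμ : ∀ (g : G) (x : X), μ (g • x) = Ad g (μ x))
    (S : Set (LieAlg G)) (p : zeroFiber (totalMoment μ S)) :
    μ (totalAct X S p.1) = sliceCoord X S p.1 := by
  have h1 : μ p.1.1 + -Ad p.1.2.1⁻¹ p.1.2.2.1 = 0 := p.2
  have h2 : μ p.1.1 = Ad p.1.2.1⁻¹ p.1.2.2.1 := by
    rw [← sub_eq_zero, sub_eq_add_neg]; exact h1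
  change μ (p.1.2.1 • p.1.1) = p.1.2.2.1
  rw [hμ, h2, Ad_mul, mul_inv_cancel, Ad_one]

variable {μ : Morphism X (LieAlg G)} (hμ : ∀ (g : G) (x : X), μ (g • x) = Ad g (μ x))
  (S : Set (LieAlg G))

/-- The morphism `(x, (g, y)) ↦ g • x` from the zero fibre to `μ⁻¹(S)`. -/
def sliceProj : Morphism (zeroFiber (totalMoment μ S)) (slicePreimage μ S) :=
  ((totalAct X S).comp (incl _)).codRestrict (slicePreimage μ S) (by
    intro p
    change μ (totalAct X S p.1) ∈ S
    rw [moment_totalAct hμ]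
    exact p.1.2.2.2)

lemma sliceProj_sliceLift (z : slicePreimage μ S) : sliceProj hμ S (sliceLift μ S z) = z :=
  Subtype.ext (one_smul G z.1)

/-- Acting by the group coordinate `g` normalizes it to `g * g⁻¹ = 1`, and the slice coordinate is
then forced by the moment equation. The section after the retraction thus stays in each orbit. -/
lemma sliceLift_sliceProj (p : zeroFiber (totalMoment μ S)) :
    (sliceLift μ S (sliceProj hμ S p)).1 = p.1.2.1 • p.1 := by
  refine Prod.ext rfl (Prod.ext (mul_inv_cancel _).symm (Subtype.ext ?_))
  exact moment_totalAct hμ S p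

lemma sliceProj_eq_of_smul {p q : zeroFiber (totalMoment μ S)} {g : G} (h : q.1 = g • p.1) :
    sliceProj hμ S q = sliceProj hμ S p := by
  refine Subtype.ext ?_
  change q.1.2.1 • q.1.1 = p.1.2.1 • p.1.1
  rw [h]
  change (p.1.2.1 * g⁻¹) • g • p.1.1 = _
  rw [mul_smul, inv_smul_smul]

/-- Pullback of functions on `μ⁻¹(S)` to invariant functions on the zero fibre. -/
def sliceProjInvariant : CoordRing (slicePreimage μ S) →ₐ[ℂ] invariants G (totalMoment μ S) :=
  (sliceProj hμ S).pullback.codRestrict _ fun f _ _ _ h =>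
    congrArg f.1 (sliceProj_eq_of_smul hμ S h)

/-- An invariant function does not notice the move along the orbit, so it is recovered from its
values on the section. -/
lemma sliceProjInvariant_pullback_sliceLift (f : invariants G (totalMoment μ S)) :
    sliceProjInvariant hμ S ((sliceLift μ S).pullback f.1) = f :=
  Subtype.ext (CoordRing.ext fun p => f.2 _ p _ (sliceLift_sliceProj hμ S p))

lemma canonicalMap_sliceProj (p : zeroFiber (totalMoment μ S)) :
    canonicalMap μ S (sliceProj hμ S p) = quotientMap G (totalMoment μ S) p :=
  (quotientMap_eq_of_smul (sliceLift_sliceProj hμ S p)).symm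

variable [IsAffineVariety (slicePreimage μ S)]

lemma exists_point_of_quotient (χ : SymplecticQuotient G (totalMoment μ S)) :
    ∃ z : slicePreimage μ S, evalAt z = χ.toHom.comp (sliceProjInvariant hμ S) :=
  IsAffineVariety.evalAt_bijective.2 _

/-- The inverse of the canonical map. -/
def quotientToSlice : Morphism (SymplecticQuotient G (totalMoment μ S)) (slicePreimage μ S) where
  toFun χ := (exists_point_of_quotient hμ S χ).choose
  regular := by
    intro f
    refine ⟨sliceProjInvariant hμ S f, funext fun χ => ?_⟩
    exact (congrArg (fun θ : _ →ₐ[ℂ] ℂ => θ f) (exists_point_of_quotient hμ S χ).choose_spec).symm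

lemma apply_quotientToSlice (χ : SymplecticQuotient G (totalMoment μ S))
    (f : CoordRing (slicePreimage μ S)) :
    f.1 (quotientToSlice hμ S χ) = χ.toHom (sliceProjInvariant hμ S f) :=
  congrArg (fun θ : _ →ₐ[ℂ] ℂ => θ f) (exists_point_of_quotient hμ S χ).choose_spec

lemma quotientToSlice_quotientMap (p : zeroFiber (totalMoment μ S)) :
    quotientToSlice hμ S (quotientMap G (totalMoment μ S) p) = sliceProj hμ S p :=
  IsAffineVariety.evalAt_bijective.1 (AlgHom.ext fun f => apply_quotientToSlice hμ S _ f)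

lemma quotientToSlice_canonicalMap (z : slicePreimage μ S) :
    quotientToSlice hμ S (canonicalMap μ S z) = z :=
  (quotientToSlice_quotientMap hμ S (sliceLift μ S z)).trans (sliceProj_sliceLift hμ S z)

lemma canonicalMap_quotientToSlice (χ : SymplecticQuotient G (totalMoment μ S)) :
    canonicalMap μ S (quotientToSlice hμ S χ) = χ := by
  refine SymplecticQuotient.ext (AlgHom.ext fun f => ?_)
  refine (apply_quotientToSlice hμ S χ ((sliceLift μ S).pullback f.1)).trans ?_
  rw [sliceProjInvariant_pullback_sliceLift]

end SliceQuotient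

/-! ### Points of the quotient are orbits. -/

section QuotientPoints

variable {G : Type u} [Group G] [HasRegularFunctions G] [IsAlgebraicGroup G]
  {X : Type v} [HasRegularFunctions X] [MulAction G X] [IsAlgebraicAction G X]
  {μ : Morphism X (LieAlg G)} (S : Set (LieAlg G)) [IsAffineVariety (slicePreimage μ S)]

lemma quotientMap_surjective (hμ : ∀ (g : G) (x : X), μ (g • x) = Ad g (μ x)) :
    Function.Surjective (quotientMap G (totalMoment μ S)).toFun := fun χ =>
  ⟨sliceLift μ S (quotientToSlice hμ S χ), canonicalMap_quotientToSlice hμ S χ⟩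

lemma quotientMap_eq_iff (hμ : ∀ (g : G) (x : X), μ (g • x) = Ad g (μ x))
    (p q : zeroFiber (totalMoment μ S)) :
    quotientMap G (totalMoment μ S) p = quotientMap G (totalMoment μ S) q ↔
      ∃ g : G, q.1 = g • p.1 := by
  refine ⟨fun h => ?_, fun ⟨g, h⟩ => quotientMap_eq_of_smul h⟩
  have h1 := congrArg (quotientToSlice hμ S).toFun h
  have h2 : sliceProj hμ S p = sliceProj hμ S q :=
    (quotientToSlice_quotientMap hμ S p).symm.trans
      (h1.trans (quotientToSlice_quotientMap hμ S q))
  have h3 := sliceLift_sliceProj hμ S p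
  rw [h2, sliceLift_sliceProj hμ S q] at h3
  refine ⟨q.1.2.1⁻¹ * p.1.2.1, ?_⟩
  rw [mul_smul, ← h3, inv_smul_smul]

end QuotientPoints

/-! ### Comparison of the symplectic forms on the zero fibre. -/

section Forms

variable {G : Type u} [Group G] [HasRegularFunctions G] [IsAlgebraicGroup G]
  {X : Type v} [HasRegularFunctions X]

lemma omegaR_apply (p : G × LieAlg G) (u₁ u₂ : Tangent p) :
    omegaR G p u₁ u₂ =
      (tangentSnd u₂).1 (killingFun (rightTriv p.1 (tangentFst u₁))) -
        (tangentSnd u₁).1 (killingFun (rightTriv p.1 (tangentFst u₂))) -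
        killingForm ℂ (LieAlg G) p.2
          ⁅rightTriv p.1 (tangentFst u₁), rightTriv p.1 (tangentFst u₂)⁆ := rfl

/-- The right trivialization of the `G`-component of a tangent vector of `X × (G × S)`. -/
def groupVelocity {S : Set (LieAlg G)} {m : X × GroupProd S} (U : Tangent m) : LieAlg G :=
  rightTriv (groupCoord X S m) ((groupCoord X S).differential m U)

/-- The derivative of `⟨z, y⟩` along a tangent vector of `X × (G × S)` at `(x, (g, y))`. -/
def sliceVelocity {S : Set (LieAlg G)} {m : X × GroupProd S} (U : Tangent m) (z : LieAlg G) : ℂ :=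
  ((sliceCoord X S).differential m U).1 (killingFun z)

lemma totalForm_apply (ω : TwoForm X) {S : Set (LieAlg G)} {m : X × GroupProd S}
    (U₁ U₂ : Tangent m) :
    totalForm ω S m U₁ U₂ = ω m.1 (tangentFst U₁) (tangentFst U₂) +
      (sliceVelocity U₂ (groupVelocity U₁) - sliceVelocity U₁ (groupVelocity U₂) -
        killingForm ℂ (LieAlg G) (sliceCoord X S m) ⁅groupVelocity U₁, groupVelocity U₂⁆) := by
  have h : totalForm ω S m U₁ U₂ = ω m.1 (tangentFst U₁) (tangentFst U₂) +
      omegaR G (((groupProdIncl S).comp (snd X (GroupProd S))) m)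
        (((groupProdIncl S).comp (snd X (GroupProd S))).differential m U₁)
        (((groupProdIncl S).comp (snd X (GroupProd S))).differential m U₂) := rfl
  rw [h, omegaR_apply]
  rfl

variable [MulAction G X] [IsAlgebraicAction G X]

lemma differential_totalAct {S : Set (LieAlg G)} {m : X × GroupProd S} (U : Tangent m)
    (f : CoordRing X) :
    ((totalAct X S).differential m U).1 f =
      fundamental (groupVelocity U) (totalAct X S m) f +
        ((actBy (groupCoord X S m)).differential m.1 (tangentFst U)).1 f := by
  have h := differential_actMor (((groupCoord X S).prodMk (fst X (GroupProd S))) m)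
    (((groupCoord X S).prodMk (fst X (GroupProd S))).differential m U) f
  have h1 : tangentFst (((groupCoord X S).prodMk (fst X (GroupProd S))).differential m U) =
    (groupCoord X S).differential m U := rfl
  have h2 : tangentSnd (((groupCoord X S).prodMk (fst X (GroupProd S))).differential m U) =
    tangentFst U := rfl
  rw [h1, h2] at h
  exact h

/-- The form `ω ⊕ Ω` on the zero fibre is the pullback of `ω` along `(x, (g, y)) ↦ g • x`. -/
lemma totalForm_zeroFiber {ω : TwoForm X} (hω : IsSymplecticForm ω) {μ : Morphism X (LieAlg G)}
    (hμ : IsHamiltonian ω μ) (S : Set (LieAlg G)) (p : zeroFiber (totalMoment μ S))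
    (u₁ u₂ : Tangent p) :
    TwoForm.pullback ((totalAct X S).comp (incl (zeroFiber (totalMoment μ S)))) ω p u₁ u₂ =
      TwoForm.pullback (incl (zeroFiber (totalMoment μ S))) (totalForm ω S) p u₁ u₂ := by
  let U : Tangent p → Tangent p.1 := (incl (zeroFiber (totalMoment μ S))).differential p
  let Y : Tangent p → LieAlg G := fun u => groupVelocity (U u)
  let q : X := totalAct X S p.1
  let F : LieAlg G → Tangent q := fun y => ⟨fundamental y q, fundamental_mem y q⟩
  let V : Tangent p → Tangent q := fun u =>
    (actBy (groupCoord X S p.1)).differential p.1.1 (tangentFst (U u))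
  have hsplit : ∀ u, (totalAct X S).differential p.1 (U u) = F (Y u) + V u := fun u =>
    Subtype.ext (LinearMap.ext fun f => differential_totalAct (U u) f)
  have hs : μ q = sliceCoord X S p.1 := moment_totalAct hμ.equivariant S p
  have hFk : ∀ y z, (F y).1 (μ.pullback (killingFun z)) =
      killingForm ℂ (LieAlg G) z ⁅y, sliceCoord X S p.1⁆ := by
    intro y z
    rw [← hs]
    exact fundamental_pullback_killingFun hμ y z q
  -- Differentiate the identity `μ (g • x) = y`, which holds on the zero fibre only: this is why `u`
  -- must be tangent to it.
  have hconstr : ∀ u z, ((totalAct X S).differential p.1 (U u)).1 (μ.pullback (killingFun z)) =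
      sliceVelocity (U u) z := by
    intro u z
    change u.1 _ = u.1 _
    congr 1
    refine CoordRing.ext fun p' => ?_
    exact congrArg (killingForm ℂ (LieAlg G) z) (moment_totalAct hμ.equivariant S p')
  have hV : ∀ u z, (V u).1 (μ.pullback (killingFun z)) =
      sliceVelocity (U u) z -
        killingForm ℂ (LieAlg G) z ⁅Y u, sliceCoord X S p.1⁆ := by
    intro u z
    rw [← hconstr, hsplit, ← hFk]
    change _ = ((F (Y u)).1 _ + (V u).1 _) - _
    ring
  have hmom : ∀ y (w : Tangent q), ω q (F y) w = w.1 (μ.pullback (killingFun y)) :=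
    fun y w => (hμ.moment y q w).symm
  have hinv : ω q (V u₁) (V u₂) = ω p.1.1 (tangentFst (U u₁)) (tangentFst (U u₂)) := by
    have := congrFun (hμ.invariant (groupCoord X S p.1)) p.1.1
    exact congrArg (fun B : Tangent p.1.1 →ₗ[ℂ] Tangent p.1.1 →ₗ[ℂ] ℂ =>
      B (tangentFst (U u₁)) (tangentFst (U u₂))) this
  have hleft : TwoForm.pullback ((totalAct X S).comp (incl (zeroFiber (totalMoment μ S)))) ω p u₁ u₂
      = ω q (F (Y u₁) + V u₁) (F (Y u₂) + V u₂) := by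
    rw [← hsplit, ← hsplit]
    rfl
  have hright : TwoForm.pullback (incl (zeroFiber (totalMoment μ S))) (totalForm ω S) p u₁ u₂ =
      totalForm ω S p.1 (U u₁) (U u₂) := rfl
  -- Bilinear expansion: the terms containing a fundamental vector become derivatives of `μ`,
  -- computed by `hFk` and `hV`, and invariance handles `ω (V u₁) (V u₂)`. Of the bracket terms two
  -- cancel, and the third is the bracket term of `omegaR`.
  rw [hleft, hright, totalForm_apply, LinearMap.map_add₂, map_add, map_add, hmom, hmom,
    hω.antisymm q (V u₁) (F (Y u₂)), hmom, hV, hV, hFk, hinv]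
  have hκ : killingForm ℂ (LieAlg G) (sliceCoord X S p.1) ⁅Y u₁, Y u₂⁆ =
      -killingForm ℂ (LieAlg G) (Y u₂) ⁅Y u₁, sliceCoord X S p.1⁆ := by
    rw [← killingForm_lie_left]
    exact LieModule.traceForm_comm ℂ (LieAlg G) (LieAlg G) _ _
  change _ = _ + (_ - _ - killingForm ℂ (LieAlg G) (sliceCoord X S p.1) ⁅Y u₁, Y u₂⁆)
  rw [hκ]
  ring

end Forms

/-! ### Existence and uniqueness of the reduced form. -/

section ReducedForm

variable {G : Type u} [Group G] [HasRegularFunctions G] [IsAlgebraicGroup G]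
  {X : Type v} [HasRegularFunctions X] [MulAction G X] [IsAlgebraicAction G X]
  {ω : TwoForm X} {μ : Morphism X (LieAlg G)}

/-- The form on the quotient that corresponds to the restriction of `ω` to `μ⁻¹(S)`. -/
def reducedForm (ω : TwoForm X) (hμ : ∀ (g : G) (x : X), μ (g • x) = Ad g (μ x))
    (S : Set (LieAlg G)) [IsAffineVariety (slicePreimage μ S)] :
    TwoForm (SymplecticQuotient G (totalMoment μ S)) :=
  TwoForm.pullback (quotientToSlice hμ S) (TwoForm.pullback (incl (slicePreimage μ S)) ω)

lemma isReducedForm_reducedForm (hω : IsSymplecticForm ω) (hμ : IsHamiltonian ω μ)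
    (S : Set (LieAlg G)) [IsAffineVariety (slicePreimage μ S)] :
    IsReducedForm G (totalMoment μ S) (totalForm ω S) (reducedForm ω hμ.equivariant S) := by
  funext p
  refine LinearMap.ext fun u₁ => LinearMap.ext fun u₂ => ?_
  rw [← totalForm_zeroFiber hω hμ S p u₁ u₂]
  have key : ∀ f : CoordRing (slicePreimage μ S),
      (quotientMap G (totalMoment μ S)).pullback
        ((quotientToSlice hμ.equivariant S).pullback f) =
        (sliceProj hμ.equivariant S).pullback f := fun f =>
    CoordRing.ext fun p' => congrArg f.1 (quotientToSlice_quotientMap hμ.equivariant S p')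
  have hdiff : ∀ u : Tangent p,
      ((quotientToSlice hμ.equivariant S).differential _
        ((quotientMap G (totalMoment μ S)).differential p u)).1 =
      ((sliceProj hμ.equivariant S).differential p u).1 := fun u =>
    LinearMap.ext fun f => congrArg u.1 (key f)
  exact TwoForm.congr_point (TwoForm.pullback (incl (slicePreimage μ S)) ω)
    (quotientToSlice_quotientMap hμ.equivariant S p) (hdiff u₁) (hdiff u₂)

lemma IsReducedForm.unique (hμ : ∀ (g : G) (x : X), μ (g • x) = Ad g (μ x))
    (S : Set (LieAlg G)) [IsAffineVariety (slicePreimage μ S)]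
    {Ω : TwoForm (X × GroupProd S)} {ω₁ ω₂ : TwoForm (SymplecticQuotient G (totalMoment μ S))}
    (h₁ : IsReducedForm G (totalMoment μ S) Ω ω₁) (h₂ : IsReducedForm G (totalMoment μ S) Ω ω₂) :
    ω₁ = ω₂ := by
  funext χ
  refine LinearMap.ext fun v₁ => LinearMap.ext fun v₂ => ?_
  let z := quotientToSlice hμ S χ
  let u : Tangent χ → Tangent (sliceLift μ S z) := fun v =>
    (sliceLift μ S).differential z ((quotientToSlice hμ S).differential χ v)
  have hpt : χ = quotientMap G (totalMoment μ S) (sliceLift μ S z) :=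
    (canonicalMap_quotientToSlice hμ S χ).symm
  -- The quotient map has a section through `sliceLift`, so every tangent vector of the quotient
  -- lifts to the zero fibre and the reduced form is determined by its pullback.
  have hu : ∀ v : Tangent χ,
      v.1 = ((quotientMap G (totalMoment μ S)).differential (sliceLift μ S z) (u v)).1 := by
    intro v
    refine LinearMap.ext fun f => congrArg v.1 (CoordRing.ext fun χ' => ?_)
    exact congrArg f.1 (canonicalMap_quotientToSlice hμ S χ').symm
  have h := congrFun (h₁.trans h₂.symm) (sliceLift μ S z)
  rw [TwoForm.congr_point ω₁ hpt (hu v₁) (hu v₂), TwoForm.congr_point ω₂ hpt (hu v₁) (hu v₂)]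
  exact LinearMap.congr_fun (LinearMap.congr_fun h (u v₁)) (u v₂)

lemma pullback_canonicalMap_reducedForm (ω : TwoForm X)
    (hμ : ∀ (g : G) (x : X), μ (g • x) = Ad g (μ x)) (S : Set (LieAlg G))
    [IsAffineVariety (slicePreimage μ S)] :
    TwoForm.pullback (canonicalMap μ S) (reducedForm ω hμ S) =
      TwoForm.pullback (incl (slicePreimage μ S)) ω := by
  funext z
  refine LinearMap.ext fun v₁ => LinearMap.ext fun v₂ => ?_
  have hdiff : ∀ v : Tangent z,
      ((quotientToSlice hμ S).differential _ ((canonicalMap μ S).differential z v)).1 = v.1 :=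
    fun v => LinearMap.ext fun f => congrArg v.1
      (CoordRing.ext fun z' => congrArg f.1 (quotientToSlice_canonicalMap hμ S z'))
  exact TwoForm.congr_point (TwoForm.pullback (incl (slicePreimage μ S)) ω)
    (quotientToSlice_canonicalMap hμ S z) (hdiff v₁) (hdiff v₂)

end ReducedForm

end AffVar

end

theorem mainTheorem10 {G : Type*} [Group G] [AffVar.HasRegularFunctions G]
    [AffVar.IsAlgebraicGroup G] [ConnectedSpace (PrimeSpectrum (AffVar.CoordRing G))]
    [LieAlgebra.HasTrivialRadical ℂ (AffVar.LieAlg G)]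
    {X : Type*} [AffVar.HasRegularFunctions X] [MulAction G X] [AffVar.IsAlgebraicAction G X]
    (ω : AffVar.TwoForm X) (hω : AffVar.IsSymplecticVariety X ω)
    (μ : AffVar.Morphism X (AffVar.LieAlg G)) (hμ : AffVar.IsHamiltonian ω μ)
    (ξ h η : AffVar.LieAlg G) (hτ : AffVar.IsTriple ξ h η)
    (S : Set (AffVar.LieAlg G)) (hS : S = AffVar.slodowySlice ξ η) :
    -- the points of the quotient are the orbits in the zero fibre
    (Function.Surjective (AffVar.quotientMap G (AffVar.totalMoment μ S)).toFun ∧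
      ∀ p q : AffVar.zeroFiber (AffVar.totalMoment μ S),
        AffVar.quotientMap G (AffVar.totalMoment μ S) p =
          AffVar.quotientMap G (AffVar.totalMoment μ S) q ↔ ∃ g : G, q.1 = g • p.1) ∧
    -- the canonical map is an isomorphism of affine varieties, with inverse `[(x, (g, y))] ↦ g • x`
    AffVar.IsAffineVariety (AffVar.slicePreimage μ S) ∧
    AffVar.IsAffineVariety (AffVar.SymplecticQuotient G (AffVar.totalMoment μ S)) ∧
    (AffVar.canonicalMap μ S).IsIso ∧
    (∀ p : AffVar.zeroFiber (AffVar.totalMoment μ S),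
      ∃ hp : p.1.2.1 • p.1.1 ∈ AffVar.slicePreimage μ S,
        AffVar.canonicalMap μ S ⟨p.1.2.1 • p.1.1, hp⟩ =
          AffVar.quotientMap G (AffVar.totalMoment μ S) p) ∧
    -- the reduced form exists, is unique and symplectic, and corresponds to the restriction of `ω`
    (∃ ω' : AffVar.TwoForm (AffVar.SymplecticQuotient G (AffVar.totalMoment μ S)),
      (∀ ω'' : AffVar.TwoForm (AffVar.SymplecticQuotient G (AffVar.totalMoment μ S)),
        AffVar.IsReducedForm G (AffVar.totalMoment μ S) (AffVar.totalForm ω S) ω'' ↔ ω'' = ω') ∧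
      AffVar.IsSymplecticVariety (AffVar.SymplecticQuotient G (AffVar.totalMoment μ S)) ω' ∧
      AffVar.TwoForm.pullback (AffVar.canonicalMap μ S) ω' =
        AffVar.TwoForm.pullback (AffVar.incl (AffVar.slicePreimage μ S)) ω) ∧
    -- the slice preimage is a symplectic subvariety
    AffVar.IsSymplecticSubvariety (AffVar.slicePreimage μ S) ω := by

  subst hS
  have hsub := AffVar.isSymplecticSubvariety_slicePreimage hω hμ hτ
  have := hsub.symplectic.affine
  have hiso₁ := AffVar.quotientToSlice_canonicalMap hμ.equivariant (AffVar.slodowySlice ξ η)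
  have hiso₂ := AffVar.canonicalMap_quotientToSlice hμ.equivariant (AffVar.slodowySlice ξ η)
  have hred := AffVar.isReducedForm_reducedForm hω.symplectic hμ (AffVar.slodowySlice ξ η)
  have hsymp := hsub.symplectic.of_iso hiso₁ hiso₂
  refine ⟨⟨AffVar.quotientMap_surjective _ hμ.equivariant,
      AffVar.quotientMap_eq_iff _ hμ.equivariant⟩,
    this, hsymp.affine, ⟨_, hiso₁, hiso₂⟩,
    fun p => ⟨(AffVar.sliceProj hμ.equivariant _ p).2, AffVar.canonicalMap_sliceProj hμ.equivariant _ p⟩,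
    ⟨AffVar.reducedForm ω hμ.equivariant _, fun ω'' => ⟨fun h' => ?_, fun h' => h' ▸ hred⟩, hsymp,
      AffVar.pullback_canonicalMap_reducedForm ω hμ.equivariant _⟩, hsub⟩
  exact h'.unique hμ.equivariant _ hred
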